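/- Let $t:\mathbb N\to\mathbb N$ be a superlinear ($n=o(t(n))$), time-constructible function ($1^n\mapsto 1^{t(n)}$ is computable by a multitape Turing machine in $O(t(n))$ steps). A martingale is a function $d:\{0,1\}^*\to[0,\infty)$ with $d(\lambda)=1$ for the empty string $\lambda$ and $d(w)=\tfrac12\,(d(w0)+d(w1))$ for all strings $w$. It succeeds on $X\in\{0,1\}^{\mathbb N}$ if $\limsup_{n\to\infty}d(X_0\dots X_{n-1})=\infty$. It is $t$-bounded if a multitape Turing machine computes the exact (rational) value $d(w)$ on input $w$, as a numerator and a denominator in binary, in $O(t(|w|))$ steps. It is $t^Y$-bounded, for $Y\in\{0,1\}^{\mathbb N}$, if this is done by a multitape Turing machine with oracle $Y$, which obtains the bit $Y_i$ in one step once the index $i$ is written in binary on its query tape. A sequence $X$ is $t$-random if no $t$-bounded martingale succeeds on $X$ (and $t$-nonrandom otherwise), and $t^Y$-random if no $t^Y$-bounded martingale succeeds on $X$. For $A,B\in\{0,1\}^{\mathbb N}$ let $A\uplus B=A_0B_0A_1B_1\dots$. Then there are sequences $A,B\in\{0,1\}^{\mathbb N}$ such that $B$ is $t$-random, $A$ is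 $t^B$-random, and $A\uplus B$ is $t$-nonrandom. -/

import Mathlib

open Filter
open scoped NNReal ENNReal

noncomputable section

namespace TimeBounded

/-- Infinite binary sequences. -/
abbrev BinSeq : Type := ℕ → Bool

/-- The prefix `X ↾ n = X₀ X₁ … X_{n-1}`. -/
def pre (X : BinSeq) (n : ℕ) : List Bool := List.ofFn fun i : Fin n => X i

/-- The interleaving `A ⊎ B = A₀ B₀ A₁ B₁ …`. -/
def interleave (A B : BinSeq) : BinSeq :=
  fun n => if n % 2 = 0 then A (n / 2) else B (n / 2)

/-! ### Oracle Turing machines with several tapes -/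

/-- The tapes of a machine: an input tape, a query tape, two output tapes (for the numerator and
the denominator of a rational number) and `k` work tapes. -/
inductive TapeName (k : ℕ) : Type
  | input : TapeName k
  | query : TapeName k
  | numer : TapeName k
  | denom : TapeName k
  | work (i : Fin k) : TapeName k

/-- A two-way infinite tape over the alphabet `{0, 1, blank}`; `none` is the blank symbol. -/
abbrev TapeContent : Type := ℤ → Option Bool

/-- The tape carrying the word `w` in the cells `0, …, |w| - 1`, blank elsewhere. -/
def tapeOf (w : List Bool) : TapeContent :=
  fun i => if 0 ≤ i then w[i.toNat]? else none

/-- The length of the block of nonblank cells that starts at cell `0`. (In every configuration that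
a computation reaches, only finitely many cells are nonblank.) -/
def blockLength (T : TapeContent) : ℕ := sInf {n : ℕ | T (n : ℤ) = none}

/-- The natural number written in binary, least significant digit first, in the block of nonblank
cells that starts at cell `0`. -/
def binaryValue (T : TapeContent) : ℕ :=
  ∑ i ∈ Finset.range (blockLength T), if T (i : ℤ) = some true then 2 ^ i else 0

/-- What a machine does in one step: halt; or ask the oracle for the bit whose index is written in
binary on the query tape and enter a state that depends on the answer; or enter a new state, write
a symbol on every tape and move every head by `-1`, `0` or `1` cells. -/
inductive Action (k : ℕ) (Q : Type) : Type
  | halt : Action k Q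
  | ask (next : Bool → Q) : Action k Q
  | act (next : Q) (op : TapeName k → Option Bool × SignType) : Action k Q

/-- A deterministic oracle Turing machine with finitely many states. The action depends on the state
and on the symbols under the heads. -/
structure Machine where
  k : ℕ
  Q : Type
  finite_states : Finite Q
  start : Q
  δ : Q → (TapeName k → Option Bool) → Action k Q

/-- A configuration: the state, the contents of the tapes and the positions of the heads. -/
structure Config (M : Machine) where
  state : M.Q
  tape : TapeName M.k → TapeContent
  head : TapeName M.k → ℤ

namespace Machine

/-- The action that the machine takes in a given configuration. -/
def action (M : Machine) (c : Config M) : Action M.k M.Q :=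
  M.δ c.state fun j => c.tape j (c.head j)

/-- One step with oracle `Z`; a halting configuration does not change any more. -/
def step (M : Machine) (Z : BinSeq) (c : Config M) : Config M :=
  match M.action c with
  | .halt => c
  | .ask next => { c with state := next (Z (binaryValue (c.tape .query))) }
  | .act next op =>
      { state := next
        tape := fun j => Function.update (c.tape j) (c.head j) (op j).1
        head := fun j => c.head j + ((op j).2 : ℤ) }

/-- The initial configuration on input `w`: the input tape carries `w`, all other tapes are blank,
and all heads are on cell `0`. -/
def init (M : Machine) (w : List Bool) : Config M where
  state := M.start
  tape := fun j => match j with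
    | .input => tapeOf w
    | _ => fun _ => none
  head := fun _ => 0

/-- The configuration after `T` steps on input `w` with oracle `Z`. -/
def run (M : Machine) (Z : BinSeq) (w : List Bool) (T : ℕ) : Config M :=
  (M.step Z)^[T] (M.init w)

def Halted (M : Machine) (c : Config M) : Prop := M.action c = .halt

/-- The machine never asks its oracle: it is an ordinary Turing machine. -/
def OracleFree (M : Machine) : Prop :=
  ∀ (q : M.Q) (s : TapeName M.k → Option Bool) (next : Bool → M.Q), M.δ q s ≠ .ask next

/-- On input `w` with oracle `Z`, the machine halts within `T` steps, with the numerator and the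
(nonzero) denominator of a fraction that represents `r` on its output tapes. -/
def OutputsWithin (M : Machine) (Z : BinSeq) (w : List Bool) (T : ℕ) (r : ℝ≥0) : Prop :=
  M.Halted (M.run Z w T) ∧
    binaryValue ((M.run Z w T).tape .denom) ≠ 0 ∧
    r = (binaryValue ((M.run Z w T).tape .numer) : ℝ≥0) /
      (binaryValue ((M.run Z w T).tape .denom) : ℝ≥0)

end Machine

/-- `t` is time-constructible: some Turing machine without oracle maps `1ⁿ` to `1^{t(n)}` in
`O(t(n))` steps. -/
def TimeConstructible (t : ℕ → ℕ) : Prop :=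
  ∃ M : Machine, M.OracleFree ∧ ∃ C : ℕ, ∀ (n : ℕ) (Z : BinSeq),
    M.Halted (M.run Z (List.replicate n true) (C * t n + C)) ∧
    (M.run Z (List.replicate n true) (C * t n + C)).tape .numer =
      tapeOf (List.replicate (t n) true)

/-- `t` is superlinear: `n = o(t(n))`. -/
def Superlinear (t : ℕ → ℕ) : Prop :=
  (fun n : ℕ => (n : ℝ)) =o[atTop] (fun n : ℕ => (t n : ℝ))

/-! ### Martingales -/

/-- A martingale on binary strings. -/
def IsMartingale (d : List Bool → ℝ≥0) : Prop :=
  d [] = 1 ∧ ∀ w : List Bool, d w = (d (w ++ [false]) + d (w ++ [true])) / 2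

/-- The martingale `d` succeeds on `X`. -/
def Succeeds (d : List Bool → ℝ≥0) (X : BinSeq) : Prop :=
  limsup (fun n : ℕ => (d (pre X n) : ℝ≥0∞)) atTop = ⊤

/-- `d` is a `t`-bounded martingale: its exact values are computed by a Turing machine without
oracle in `O(t(|w|))` steps. -/
def IsBoundedMartingale (t : ℕ → ℕ) (d : List Bool → ℝ≥0) : Prop :=
  IsMartingale d ∧ ∃ M : Machine, M.OracleFree ∧ ∃ C : ℕ, ∀ (w : List Bool) (Z : BinSeq),
    M.OutputsWithin Z w (C * t w.length + C) (d w)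

/-- `d` is a `t^Y`-bounded martingale: its exact values are computed by an oracle Turing machine
with oracle `Y` in `O(t(|w|))` steps. Nothing is required of the machine for other oracles. -/
def IsBoundedMartingaleRel (t : ℕ → ℕ) (Y : BinSeq) (d : List Bool → ℝ≥0) : Prop :=
  IsMartingale d ∧ ∃ M : Machine, ∃ C : ℕ, ∀ w : List Bool,
    M.OutputsWithin Y w (C * t w.length + C) (d w)

/-- `X` is `t`-random. -/
def IsRandom (t : ℕ → ℕ) (X : BinSeq) : Prop :=
  ¬ ∃ d : List Bool → ℝ≥0, IsBoundedMartingale t d ∧ Succeeds d X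

/-- `X` is `t^Y`-random, that is, `t`-random with respect to `Y`. -/
def IsRandomRel (t : ℕ → ℕ) (Y X : BinSeq) : Prop :=
  ¬ ∃ d : List Bool → ℝ≥0, IsBoundedMartingaleRel t Y d ∧ Succeeds d X

end TimeBounded

end

/-! Take `B = Y` and `A = Y ∘ b`, where the positions `b 0 < b 1 < …` are very sparse but can be
recognized in linear time.

Randomness (`exists_random_comp`): a `t^Y`-bounded martingale fixes its bet on `A n = Y (b n)` after
evaluating words of length at most `n + 1`. In that time it can only query indices below `2 ^ (C * t
m + C)`, `m ≤ n + 1` (`Machine.run_congr`), and for large `n` these lie below `b n`. So the bet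
depends on `Y ↾ b n` alone and can be placed by a martingale on `Y` itself at position `b n`
(`le_transfer`). Together with the `t`-bounded martingales these strategies form a countable family,
and some `Y`, not required to be computable, keeps all of them bounded (`exists_forall_bounded`).

Nonrandomness: `A n` stands at position `2n` of `A ⊎ B` and reappears as `B (b n)` at position `2 b
n + 1`. Staking everything on this repetition doubles the capital infinitely often
(`succeeds_pairRatio`). As `t` is superlinear, linear time is enough
(`isBoundedMartingale_pairRatio`), provided that the positions `b n` are found while the input is
being read. They are therefore given by the ticks of a machine that makes one step per pair of bits.
It runs the machine for `t` on `1⁰, 1¹, …`; the `j`-th of these runs takes at least `t j` steps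
(`TimeConstructible.exists_auto`). Two nested exponential clocks slow it down enough to beat every
constant `C` (`Auto.slow_ticks`). Only the ticks with even number `2i` are used: a head that
advances one cell per tick then stands on cell `2i`, which holds `A i`. -/

noncomputable section

namespace TimeBounded

/-! ### Martingales given by betting ratios -/

theorem pre_succ (X : BinSeq) (n : ℕ) : pre X (n + 1) = pre X n ++ [X n] := by
  unfold pre
  rw [List.ofFn_succ_last]
  rfl

@[simp] theorem length_pre (X : BinSeq) (n : ℕ) : (pre X n).length = n := by
  simp [pre]

/-- The capital process that starts with capital `1` and multiplies the capital by `ρ v a` when the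
bit `a` appears after the prefix `v`. -/
def betProduct (ρ : List Bool → Bool → ℝ≥0) (w : List Bool) : ℝ≥0 :=
  ∏ i ∈ Finset.range w.length, ρ (w.take i) (w.getD i false)

@[simp] theorem betProduct_nil (ρ : List Bool → Bool → ℝ≥0) : betProduct ρ [] = 1 := by
  simp [betProduct]

theorem betProduct_append (ρ : List Bool → Bool → ℝ≥0) (w : List Bool) (a : Bool) :
    betProduct ρ (w ++ [a]) = betProduct ρ w * ρ w a := by
  unfold betProduct
  rw [List.length_append, List.length_singleton, Finset.prod_range_succ]
  congr 1
  · refine Finset.prod_congr rfl fun i hi => ?_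
    rw [Finset.mem_range] at hi
    rw [List.take_append_of_le_length hi.le, List.getD_append _ _ _ _ hi]
  · simp

theorem isMartingale_betProduct {ρ : List Bool → Bool → ℝ≥0}
    (h : ∀ w, ρ w false + ρ w true = 2) : IsMartingale (betProduct ρ) := by
  refine ⟨betProduct_nil ρ, fun w => ?_⟩
  rw [betProduct_append, betProduct_append, ← mul_add, h]
  simp

theorem not_succeeds_of_bounded {d : List Bool → ℝ≥0} {X : BinSeq} {K : ℝ≥0} {n₀ : ℕ}
    (h : ∀ n, n₀ ≤ n → d (pre X n) ≤ K) : ¬ Succeeds d X := by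
  intro hs
  have h1 : limsup (fun n : ℕ => (d (pre X n) : ℝ≥0∞)) atTop ≤ (K : ℝ≥0∞) := by
    refine limsup_le_of_le (h := ?_)
    filter_upwards [eventually_ge_atTop n₀] with n hn
    exact_mod_cast h n hn
  rw [Succeeds] at hs
  rw [hs] at h1
  exact absurd h1 (by simp)

theorem succeeds_of_unbounded {d : List Bool → ℝ≥0} {X : BinSeq}
    (h : ∀ K : ℕ, ∀ n₀, ∃ n, n₀ ≤ n ∧ (K : ℝ≥0) ≤ d (pre X n)) : Succeeds d X := by
  unfold Succeeds
  refine ENNReal.eq_top_of_forall_nnreal_le fun r => ?_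
  obtain ⟨K, hK⟩ := exists_nat_ge r
  refine le_limsup_of_frequently_le ?_
  rw [frequently_atTop]
  intro n₀
  obtain ⟨n, hn, hd⟩ := h K n₀
  exact ⟨n, hn, by exact_mod_cast hK.trans hd⟩

/-- This crude bound makes weighted sums of countably many martingales converge. -/
theorem IsMartingale.le_two_pow {d : List Bool → ℝ≥0} (hd : IsMartingale d) (w : List Bool) :
    d w ≤ 2 ^ w.length := by
  induction w using List.reverseRecOn with
  | nil => simp [hd.1]
  | append_singleton w a ih =>
    have h := hd.2 w
    have h2 : d (w ++ [false]) + d (w ++ [true]) = 2 * d w := by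
      rw [h]; field_simp
    have h3 : d (w ++ [a]) ≤ 2 * d w := by
      rw [← h2]; cases a
      · exact le_self_add
      · exact le_add_self
    rw [List.length_append, List.length_singleton, pow_succ]
    calc d (w ++ [a]) ≤ 2 * d w := h3
      _ ≤ 2 * 2 ^ w.length := by gcongr
      _ = _ := by ring

/-- For countably many martingales there is a sequence along which each of them is bounded. -/
theorem exists_forall_bounded {ι : Type*} [Countable ι] (F : ι → List Bool → ℝ≥0)
    (hF : ∀ i, IsMartingale (F i)) :
    ∃ X : BinSeq, ∀ i, ∃ K : ℝ≥0, ∀ n, F i (pre X n) ≤ K := by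
  obtain ⟨w, hw0, c, hwc, hc⟩ := NNReal.exists_pos_sum_of_countable (ε := 1) one_ne_zero ι
  have hsum : ∀ v, Summable fun i => w i * F i v := fun v => by
    refine NNReal.summable_of_le (f := fun i => w i * 2 ^ v.length) (fun i => ?_)
      (hwc.summable.mul_right _)
    exact mul_le_mul_right ((hF i).le_two_pow v) _
  let S : List Bool → ℝ≥0 := fun v => ∑' i, w i * F i v
  have hS : ∀ v, S (v ++ [false]) + S (v ++ [true]) = 2 * S v := fun v => by
    simp only [S]
    rw [← (hsum _).tsum_add (hsum _), ← NNReal.tsum_mul_left]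
    refine tsum_congr fun i => ?_
    rw [← mul_add, (hF i).2 v]
    field_simp
  have hex : ∀ v, ∃ a : Bool, S (v ++ [a]) ≤ S v := fun v => by
    by_contra! h
    have := add_lt_add (h false) (h true)
    rw [hS, two_mul] at this
    exact lt_irrefl _ this
  -- `S` is fair, so at every word one of the two extensions does not increase it; `X` always
  -- follows such an extension.
  choose a ha using hex
  let V : ℕ → List Bool := fun n => Nat.rec [] (fun _ v => v ++ [a v]) n
  have hV : ∀ n, V (n + 1) = V n ++ [a (V n)] := fun n => rfl
  let X : BinSeq := fun n => a (V n)
  have hX : ∀ n, pre X n = V n := fun n => by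
    induction n with
    | zero => simp [pre, V]
    | succ n ih => rw [pre_succ, hV, ih]
  have hle : ∀ n, S (pre X n) ≤ S [] := fun n => by
    induction n with
    | zero => simp [pre]
    | succ n ih => rw [hX, hV]; rw [hX] at ih; exact (ha _).trans ih
  refine ⟨X, fun i => ⟨(w i)⁻¹ * S [], fun n => ?_⟩⟩
  -- A single summand is at most the mixture, so each martingale is bounded up to the factor given
  -- by its weight.
  have h1 : w i * F i (pre X n) ≤ S [] :=
    ((hsum (pre X n)).le_tsum i (fun _ _ => zero_le)).trans (hle n)
  rwa [mul_comm (w i)⁻¹, ← div_eq_mul_inv, le_div_iff₀ (hw0 i), mul_comm]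

/-! ### Locality of oracle computations -/

namespace Machine

theorem run_succ (M : Machine) (Z : BinSeq) (w : List Bool) (T : ℕ) :
    M.run Z w (T + 1) = M.step Z (M.run Z w T) :=
  Function.iterate_succ_apply' _ _ _

/-- After `T` steps a tape that was blank from cell `m` on is blank from cell `m + T` on. -/
theorem head_le_and_blank (M : Machine) (Z : BinSeq) (w : List Bool) (j : TapeName M.k) (m : ℤ)
    (hm : 0 ≤ m) (hj : ∀ i, m ≤ i → (M.init w).tape j i = none) (T : ℕ) :
    (M.run Z w T).head j ≤ T ∧ ∀ i, m + T ≤ i → (M.run Z w T).tape j i = none := by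
  induction T with
  | zero => exact ⟨le_refl _, fun i hi => hj i (by simpa using hi)⟩
  | succ T ih =>
    obtain ⟨h1, h2⟩ := ih
    rw [run_succ]
    generalize M.run Z w T = c at h1 h2
    unfold step
    push_cast
    split
    · exact ⟨by lia, fun i hi => h2 i (by lia)⟩
    · exact ⟨by simp only; lia, fun i hi => h2 i (by lia)⟩
    · rename_i next op _
      refine ⟨?_, fun i hi => ?_⟩
      · have : ((op j).2 : ℤ) ≤ 1 := by cases (op j).2 <;> simp
        simp only; lia
      · simp only
        rw [Function.update_of_ne (by lia)]
        exact h2 i (by lia)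

theorem blockLength_le {T : TapeContent} {n : ℕ} (h : T n = none) : blockLength T ≤ n :=
  Nat.sInf_le h

theorem binaryValue_lt (T : TapeContent) : binaryValue T < 2 ^ blockLength T := by
  unfold binaryValue
  calc _ ≤ ∑ i ∈ Finset.range (blockLength T), 2 ^ i :=
        Finset.sum_le_sum fun i _ => by split <;> simp
    _ < _ := by rw [Nat.geomSum_eq le_rfl]; simp

/-- The query tape starts blank and its head moves right at most one cell per step, so the index has
at most `T` binary digits. -/
theorem query_lt (M : Machine) (Z : BinSeq) (w : List Bool) (T : ℕ) :
    binaryValue ((M.run Z w T).tape .query) < 2 ^ T := by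
  refine (binaryValue_lt _).trans_le (Nat.pow_le_pow_right (by norm_num) (blockLength_le ?_))
  exact (M.head_le_and_blank Z w .query 0 le_rfl (fun _ _ => rfl) T).2 _ (by simp)

theorem run_congr (M : Machine) {Z Z' : BinSeq} (w : List Bool) (T : ℕ)
    (h : ∀ i < 2 ^ T, Z i = Z' i) : M.run Z w T = M.run Z' w T := by
  induction T with
  | zero => rfl
  | succ T ih =>
    have hT : 2 ^ T < 2 ^ (T + 1) := Nat.pow_lt_pow_right (by norm_num) (by lia)
    have hq := M.query_lt Z w T
    rw [run_succ, run_succ, ← ih fun i hi => h i (hi.trans hT)]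
    generalize M.run Z w T = c at hq
    unfold step
    split
    · rfl
    · rw [h _ (hq.trans hT)]
    · rfl

end Machine

/-! ### There are countably many machines -/

/-- Machines with state set `Fin q`, as tables. -/
abbrev MachineCode : Type :=
  Σ k q : ℕ, Fin q × (Fin q → (TapeName k → Option Bool) → Action k (Fin q))

def tapeNameEquiv (k : ℕ) : TapeName k ≃ Fin 4 ⊕ Fin k where
  toFun
    | .input => .inl 0
    | .query => .inl 1
    | .numer => .inl 2
    | .denom => .inl 3
    | .work i => .inr i
  invFun
    | .inl 0 => .input
    | .inl 1 => .query
    | .inl 2 => .numer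
    | .inl 3 => .denom
    | .inr i => .work i
  left_inv x := by cases x <;> rfl
  right_inv x := by
    rcases x with x | x
    · fin_cases x <;> rfl
    · rfl

instance (k : ℕ) : Finite (TapeName k) := Finite.of_equiv _ (tapeNameEquiv k).symm

instance : Finite SignType := Fintype.finite inferInstance

instance {k : ℕ} {Q : Type} [Finite Q] : Countable (Action k Q) := by
  let f : Action k Q → Option ((Bool → Q) ⊕ Q × (TapeName k → Option Bool × SignType)) := fun a =>
    match a with
    | .halt => none
    | .ask next => some (.inl next)
    | .act next op => some (.inr (next, op))
  refine Function.Injective.countable (f := f) fun a b h => ?_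
  cases a <;> cases b <;> simp_all [f]

namespace MachineCode

def toMachine (m : MachineCode) : Machine where
  k := m.1
  Q := Fin m.2.1
  finite_states := inferInstance
  start := m.2.2.1
  δ := m.2.2.2

end MachineCode

def Action.map {k : ℕ} {Q Q' : Type} (e : Q → Q') : Action k Q → Action k Q'
  | .halt => .halt
  | .ask next => .ask fun b => e (next b)
  | .act next op => .act (e next) op

/-- Renaming the states of a machine by numbers. -/
def Machine.code (M : Machine) {q : ℕ} (e : M.Q ≃ Fin q) : MachineCode :=
  ⟨M.k, q, e M.start, fun s r => (M.δ (e.symm s) r).map e⟩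

theorem Machine.run_code (M : Machine) {q : ℕ} (e : M.Q ≃ Fin q) (Z : BinSeq) (w : List Bool)
    (T : ℕ) : (M.code e).toMachine.run Z w T =
      { state := e (M.run Z w T).state
        tape := (M.run Z w T).tape
        head := (M.run Z w T).head } := by
  induction T with
  | zero =>
    have : (fun j => (M.init w).tape j) = fun j => ((M.code e).toMachine.init w).tape j := by
      funext j
      cases j <;> rfl
    exact congrArg (fun τ => (⟨e M.start, τ, fun _ => 0⟩ : Config (M.code e).toMachine)) this.symm
  | succ T ih =>
    rw [run_succ, run_succ, ih]
    generalize M.run Z w T = c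
    have ha : (M.code e).toMachine.action ⟨e c.state, c.tape, c.head⟩ = (M.action c).map e := by
      simp [action, code, MachineCode.toMachine]
    unfold step
    rw [ha]
    cases h : M.action c <;> rfl

/-- The states of a machine may come from any type; renaming them by numbers changes no computation,
so the countably many tables suffice for the diagonalization. -/
theorem Machine.exists_code (M : Machine) :
    ∃ m : MachineCode, ∀ Z w T r,
      M.OutputsWithin Z w T r → m.toMachine.OutputsWithin Z w T r := by
  obtain ⟨q, ⟨e⟩⟩ := M.finite_states.exists_equiv_fin
  refine ⟨M.code e, fun Z w T r ⟨h1, h2, h3⟩ => ?_⟩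
  refine ⟨?_, ?_, ?_⟩
  · rw [run_code]
    unfold Halted at h1 ⊢
    have : (M.code e).toMachine.action ⟨e (M.run Z w T).state, (M.run Z w T).tape,
        (M.run Z w T).head⟩ = (M.action (M.run Z w T)).map e := by
      simp [action, code, MachineCode.toMachine]
    exact this.trans (by rw [h1]; rfl)
  · rw [run_code]; exact h2
  · rw [run_code]; exact h3

/-! ### The two sequences -/

/-- The fraction on the output tapes after `T` steps. -/
def Machine.value (M : Machine) (Z : BinSeq) (w : List Bool) (T : ℕ) : ℝ≥0 :=
  (binaryValue ((M.run Z w T).tape .numer) : ℝ≥0) / (binaryValue ((M.run Z w T).tape .denom) : ℝ≥0)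

/-- The bits of `v` at the positions `b 0, …, b (n - 1)`. -/
def subword (b : ℕ → ℕ) (v : List Bool) (n : ℕ) : List Bool :=
  pre (fun i => v.getD (b i) false) n

open Classical in
/-- The betting ratio that is `f (u ++ [a]) / f u` if this is fair, and `1` otherwise. -/
def fairRatio (f : List Bool → ℝ≥0) (u : List Bool) (a : Bool) : ℝ≥0 :=
  if f u ≠ 0 ∧ f u = (f (u ++ [false]) + f (u ++ [true])) / 2 then f (u ++ [a]) / f u else 1

theorem fairRatio_add (f : List Bool → ℝ≥0) (u : List Bool) :
    fairRatio f u false + fairRatio f u true = 2 := by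
  unfold fairRatio
  split_ifs with h
  · rw [← add_div, div_eq_iff h.1]
    have := h.2
    field_simp at this
    rw [← this, mul_comm]
  · norm_num

open Classical in
/-- The ratio of the strategy that bets at the positions `b n`, `n ≥ n₀`, as the machine `M` does
for the `n`-th bit of the sequence of the bits at the positions `b 0, b 1, …`. -/
def transferRatio (M : Machine) (T b : ℕ → ℕ) (n₀ : ℕ) (v : List Bool) (a : Bool) : ℝ≥0 :=
  if h : ∃ n, n₀ ≤ n ∧ b n = v.length then
    fairRatio (fun u => M.value (fun i => v.getD i false) u (T u.length)) (subword b v h.choose) a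
  else 1

theorem transferRatio_add (M : Machine) (T b : ℕ → ℕ) (n₀ : ℕ) (v : List Bool) :
    transferRatio M T b n₀ v false + transferRatio M T b n₀ v true = 2 := by
  unfold transferRatio
  split_ifs
  · exact fairRatio_add _ _
  · norm_num

theorem pre_getD (X : BinSeq) {m i : ℕ} (h : i < m) : (pre X m).getD i false = X i := by
  simp [pre, List.getD_eq_getElem?_getD, h]

/-- Between the positions `b n` the transferred strategy does not bet. At `b n` it multiplies its
capital by the same factor as `d`, because the values of `d` that matter are computed without
looking at `Y` from `b n` on. -/
theorem le_transfer (M : Machine) (T b : ℕ → ℕ) (n₀ : ℕ) (hb : StrictMono b)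
    (hT : ∀ i, n₀ ≤ i → ∀ n ≤ i + 1, 2 ^ T n ≤ b i) (Y : BinSeq) (d : List Bool → ℝ≥0)
    (hd : IsMartingale d) (hM : ∀ w, d w = M.value Y w (T w.length)) (n : ℕ) (hn : n₀ ≤ n) :
    d (pre (Y ∘ b) n) ≤ d (pre (Y ∘ b) n₀) * betProduct (transferRatio M T b n₀) (pre Y (b n)) := by
  have hone : ∀ m, (∀ n, n₀ ≤ n → b n ≠ m) →
      betProduct (transferRatio M T b n₀) (pre Y (m + 1)) =
        betProduct (transferRatio M T b n₀) (pre Y m) := fun m hm => by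
    rw [pre_succ, betProduct_append, transferRatio, dif_neg, mul_one]
    rintro ⟨n, h1, h2⟩
    exact hm n h1 (by simpa using h2)
  have hconst : ∀ m₁ m₂, m₁ ≤ m₂ → (∀ n, n₀ ≤ n → m₁ ≤ b n → m₂ ≤ b n) →
      betProduct (transferRatio M T b n₀) (pre Y m₂) =
        betProduct (transferRatio M T b n₀) (pre Y m₁) := fun m₁ m₂ h => by
    induction m₂, h using Nat.le_induction with
    | base => exact fun _ => rfl
    | succ m hm ih =>
      intro h
      rw [hone m, ih fun n hn hb => (Nat.le_succ m).trans (h n hn hb)]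
      intro n hn hbm
      have := h n hn (hbm ▸ hm)
      lia
  induction n, hn using Nat.le_induction with
  | base =>
    rw [hconst 0 (b n₀) (Nat.zero_le _) fun n hn _ => hb.monotone hn]
    simp [pre]
  | succ n hn ih =>
    rw [hconst (b n + 1) (b (n + 1)) (hb (Nat.lt_succ_self n)) fun i hi h => by
      have : n < i := hb.lt_iff_lt.1 h
      exact hb.monotone this]
    -- The oracle that continues `Y ↾ b n` by `false` cannot be told from `Y` within the allowed
    -- time.
    have hval : ∀ u : List Bool, u.length ≤ n + 1 →
        M.value (fun i => (pre Y (b n)).getD i false) u (T u.length) = d u := fun u hu => by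
      rw [hM, Machine.value, Machine.value, M.run_congr u (T u.length) (Z' := Y)]
      exact fun i hi => pre_getD Y (hi.trans_le (hT n hn _ hu))
    have hsub : subword b (pre Y (b n)) n = pre (Y ∘ b) n := by
      unfold subword pre
      congr 1
      funext i
      exact pre_getD Y (hb i.2)
    have hex : ∃ i, n₀ ≤ i ∧ b i = (pre Y (b n)).length := ⟨n, hn, by simp⟩
    have hch : hex.choose = n := hb.injective (by simpa using hex.choose_spec.2)
    have hfair := hd.2 (pre (Y ∘ b) n)
    rw [pre_succ Y, betProduct_append, transferRatio, dif_pos hex, hch, hsub, fairRatio,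
      hval _ (by simp), hval _ (by simp), hval _ (by simp), hval _ (by simp), pre_succ (Y ∘ b)]
    -- Once `d` has lost everything it stays at `0`, so the default ratio `1` does no harm.
    by_cases h0 : d (pre (Y ∘ b) n) = 0
    · have : d (pre (Y ∘ b) n ++ [(Y ∘ b) n]) = 0 := by
        rw [h0, eq_comm, div_eq_zero_iff, add_eq_zero] at hfair
        rcases hfair with h | h
        · cases h' : (Y ∘ b) n
          · exact h.1
          · exact h.2
        · exact absurd h (by norm_num)
      rw [this]; exact zero_le
    · rw [if_pos ⟨h0, hfair⟩, ← mul_assoc]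
      calc d (pre (Y ∘ b) n ++ [(Y ∘ b) n])
          = d (pre (Y ∘ b) n) * (d (pre (Y ∘ b) n ++ [Y (b n)]) / d (pre (Y ∘ b) n)) := by
            rw [mul_div_cancel₀ _ h0]; rfl
        _ ≤ _ := mul_le_mul_left ih _

/-- If `b` grows fast enough, there is a `t`-random sequence `Y` whose subsequence `Y ∘ b` is
`t^Y`-random. -/
theorem exists_random_comp (t b : ℕ → ℕ) (hb : StrictMono b)
    (hgrow : ∀ C : ℕ, ∃ n₀, ∀ i, n₀ ≤ i → ∀ n ≤ i + 1, 2 ^ (C * t n + C) ≤ b i) :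
    ∃ Y : BinSeq, IsRandom t Y ∧ IsRandomRel t Y (Y ∘ b) := by
  classical
  choose n₀ hn₀ using hgrow
  let V : MachineCode × ℕ → List Bool → ℝ≥0 := fun p w =>
    p.1.toMachine.value (fun _ => false) w (p.2 * t w.length + p.2)
  -- The left summand lists all `t`-bounded martingales by code and time constant, with the constant
  -- `1` where a code does not compute a martingale. The right summand lists the transferred
  -- strategies, which are fair for every code.
  let F : (MachineCode × ℕ) ⊕ (MachineCode × ℕ) → List Bool → ℝ≥0
    | .inl p => if IsMartingale (V p) then V p else fun _ => 1
    | .inr p => betProduct (transferRatio p.1.toMachine (fun n => p.2 * t n + p.2) b (n₀ p.2))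
  obtain ⟨Y, hY⟩ := exists_forall_bounded F fun i => by
    rcases i with p | p
    · simp only [F]
      split_ifs with h
      · exact h
      · exact ⟨rfl, fun _ => by norm_num⟩
    · exact isMartingale_betProduct (transferRatio_add _ _ _ _)
  refine ⟨Y, ?_, ?_⟩
  · rintro ⟨d, ⟨hd, M, -, C, hM⟩, hs⟩
    obtain ⟨m, hm⟩ := M.exists_code
    have hV : V (m, C) = d := funext fun w => ((hm _ _ _ _ (hM w fun _ => false)).2.2).symm
    obtain ⟨K, hK⟩ := hY (.inl (m, C))
    refine not_succeeds_of_bounded (K := K) (n₀ := 0) (fun n _ => ?_) hs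
    have := hK n
    simp only [F] at this
    rwa [hV, if_pos hd] at this
  · rintro ⟨d, ⟨hd, M, C, hM⟩, hs⟩
    obtain ⟨m, hm⟩ := M.exists_code
    obtain ⟨K, hK⟩ := hY (.inr (m, C))
    refine not_succeeds_of_bounded (K := d (pre (Y ∘ b) (n₀ C)) * K) (n₀ := n₀ C)
      (fun n hn => ?_) hs
    refine (le_transfer m.toMachine (fun n => C * t n + C) b (n₀ C) hb (hn₀ C) Y d hd
      (fun w => (hm _ _ _ _ (hM w)).2.2) n hn).trans ?_
    exact mul_le_mul_right (hK _) _

/-! ### Tapes seen from their heads -/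

/-- A tape seen from its head at cell `0`, after writing `op.1` and moving the head by `op.2`. -/
def shiftTape (op : Option Bool × SignType) (T : TapeContent) : TapeContent :=
  fun i => Function.update T 0 op.1 (i + (op.2 : ℤ))

/-- The tape with ones in the cells `a, …, b - 1`, blank elsewhere. -/
def seg (a b : ℤ) : TapeContent := fun i => if a ≤ i ∧ i < b then some true else none

@[simp] theorem shiftTape_idle (T : TapeContent) : shiftTape (T 0, 0) T = T := by
  funext i; simp [shiftTape]

theorem shiftTape_keep (T : TapeContent) (m : SignType) :
    shiftTape (T 0, m) T = fun i => T (i + (m : ℤ)) := by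
  funext i; simp [shiftTape]

theorem shiftTape_seg (a b : ℤ) (m : SignType) :
    shiftTape (seg a b 0, m) (seg a b) = seg (a - m) (b - m) := by
  rw [shiftTape_keep]
  funext i
  simp only [seg]
  congr 1
  simp only [eq_iff_iff]
  constructor <;> rintro ⟨h1, h2⟩ <;> constructor <;> lia

theorem shiftTape_seg_push {a : ℤ} (ha : a ≤ 0) (m : SignType) :
    shiftTape (some true, m) (seg a 0) = seg (a - m) (1 - m) := by
  funext i
  simp only [shiftTape, seg, Function.update_apply]
  split_ifs <;> first | rfl | lia

theorem shiftTape_seg_pop (a : ℤ) (m : SignType) :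
    shiftTape (none, m) (seg a 1) = seg (a - m) (-m) := by
  funext i
  simp only [shiftTape, seg, Function.update_apply]
  split_ifs <;> first | rfl | lia

theorem seg_of_le {a b : ℤ} (h : b ≤ a) : seg a b = fun _ => none := by
  funext i
  simp only [seg]
  split_ifs <;> first | rfl | lia

theorem seg_some {a b i : ℤ} (h1 : a ≤ i) (h2 : i < b) : seg a b i = some true := by
  simp [seg, h1, h2]

theorem seg_none {a b i : ℤ} (h : i < a ∨ b ≤ i) : seg a b i = none := by
  rw [seg, if_neg (by lia)]

/-! ### Autonomous machines -/

/-- A Turing machine without input, with one tape for each element of `ι`, that runs for ever and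
ticks in certain configurations. -/
structure Auto (ι : Type) where
  Q : Type
  finite_states : Finite Q
  start : Q
  δ : Q → (ι → Option Bool) → Q × (ι → Option Bool × SignType)
  tick : Q → (ι → Option Bool) → Bool

namespace Auto

variable {ι κ : Type}

/-- Configurations; tapes are seen from their heads. -/
abbrev Conf (D : Auto ι) : Type := D.Q × (ι → TapeContent)

def next (D : Auto ι) (c : D.Conf) : D.Conf :=
  ((D.δ c.1 fun x => c.2 x 0).1, fun x => shiftTape ((D.δ c.1 fun y => c.2 y 0).2 x) (c.2 x))

def TickAt (D : Auto ι) (c : D.Conf) : Prop := (D.tick c.1 fun x => c.2 x 0) = true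

def conf (D : Auto ι) (s : ℕ) : D.Conf := D.next^[s] (D.start, fun _ _ => none)

/-- The machine ticks at time `s`. -/
def Ticks (D : Auto ι) (s : ℕ) : Prop := D.TickAt (D.conf s)

instance (D : Auto ι) : DecidablePred D.Ticks := fun s =>
  inferInstanceAs (Decidable ((D.tick (D.conf s).1 fun x => (D.conf s).2 x 0) = true))

theorem conf_succ (D : Auto ι) (s : ℕ) : D.conf (s + 1) = D.next (D.conf s) :=
  Function.iterate_succ_apply' _ _ _

/-- The machine that runs `G` and makes a step of `E` whenever `G` ticks. -/
def drive (G : Auto ι) (E : Auto κ) : Auto (ι ⊕ κ) where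
  Q := G.Q × E.Q
  finite_states := by
    have := G.finite_states
    have := E.finite_states
    infer_instance
  start := (G.start, E.start)
  δ q r :=
    if G.tick q.1 fun x => r (.inl x) then
      (((G.δ q.1 fun x => r (.inl x)).1, (E.δ q.2 fun x => r (.inr x)).1),
        Sum.elim (G.δ q.1 fun x => r (.inl x)).2 (E.δ q.2 fun x => r (.inr x)).2)
    else
      (((G.δ q.1 fun x => r (.inl x)).1, q.2),
        Sum.elim (G.δ q.1 fun x => r (.inl x)).2 fun x => (r (.inr x), 0))
  tick q r := (G.tick q.1 fun x => r (.inl x)) && E.tick q.2 fun x => r (.inr x)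

/-- The local time of `E` is the number of earlier ticks of `G`. -/
theorem drive_conf (G : Auto ι) (E : Auto κ) (s : ℕ) :
    (G.drive E).conf s = (((G.conf s).1, (E.conf (Nat.count G.Ticks s)).1),
      Sum.elim (G.conf s).2 (E.conf (Nat.count G.Ticks s)).2) := by
  induction s with
  | zero =>
    refine Prod.ext rfl (funext fun x => ?_)
    cases x <;> rfl
  | succ s ih =>
    rw [conf_succ, ih, conf_succ, Nat.count_succ]
    by_cases h : G.Ticks s
    · rw [if_pos h, conf_succ]
      have h' : (G.tick (G.conf s).1 fun x => (G.conf s).2 x 0) = true := h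
      simp only [next, drive, Sum.elim_inl, Sum.elim_inr, h', if_true]
      refine Prod.ext rfl (funext fun x => ?_)
      cases x <;> rfl
    · rw [if_neg h, add_zero]
      have h' : (G.tick (G.conf s).1 fun x => (G.conf s).2 x 0) = false := by
        simpa [Ticks, TickAt] using h
      simp only [next, drive, Sum.elim_inl, Sum.elim_inr, h', Bool.false_eq_true, if_false]
      refine Prod.ext rfl (funext fun x => ?_)
      cases x
      · rfl
      · exact shiftTape_idle _

theorem drive_ticks (G : Auto ι) (E : Auto κ) (s : ℕ) :
    (G.drive E).Ticks s ↔ G.Ticks s ∧ E.Ticks (Nat.count G.Ticks s) := by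
  unfold Ticks TickAt
  rw [drive_conf]
  simp only [drive, Sum.elim_inl, Sum.elim_inr, Bool.and_eq_true]
  rfl

theorem count_drive_ticks (G : Auto ι) (E : Auto κ) (s : ℕ) :
    Nat.count (G.drive E).Ticks s = Nat.count E.Ticks (Nat.count G.Ticks s) := by
  induction s with
  | zero => simp
  | succ s ih =>
    rw [Nat.count_succ, Nat.count_succ, ih]
    by_cases h : G.Ticks s
    · rw [if_pos h, Nat.count_succ]
      simp [drive_ticks, h]
    · rw [if_neg h, if_neg (by simp [drive_ticks, h]), add_zero, add_zero]

theorem drive_infinite {G : Auto ι} {E : Auto κ} (hG : {s | G.Ticks s}.Infinite)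
    (hE : {s | E.Ticks s}.Infinite) : {s | (G.drive E).Ticks s}.Infinite := by
  rw [Set.infinite_iff_exists_gt]
  intro N
  obtain ⟨e, he, hN⟩ := hE.exists_gt N
  refine ⟨Nat.nth G.Ticks e, (drive_ticks G E _).2 ⟨Nat.nth_mem_of_infinite hG e, ?_⟩, ?_⟩
  · rw [Nat.count_nth_of_infinite hG]; exact he
  · exact hN.trans_le ((Nat.nth_strictMono hG).le_apply)

/-! ### A clock with exponentially growing pauses -/

/-- Two tapes hold numbers in unary. The machine takes the first number down to `0` and adds `2` to
the second one at every step, then ticks, adds `1` and exchanges their roles. -/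
def clock : Auto Bool where
  Q := Bool × Bool
  finite_states := inferInstance
  start := (false, false)
  δ q r :=
    if q.2 then ((q.1, false), fun x => if x = q.1 then (r x, 0) else (some true, 1))
    else if (r q.1).isSome then
      ((q.1, true), fun x => if x = q.1 then (none, -1) else (some true, 1))
    else ((!q.1, false), fun x => if x = q.1 then (r x, 0) else (some true, 0))
  tick q r := !q.2 && !(r q.1).isSome

/-- The tapes of the clock with the number `u` on tape `p` and the number `v` on the other tape. -/
def clockTapes (p : Bool) (u v : ℕ) : Bool → TapeContent :=
  fun x => if x = p then seg (1 - u) 1 else seg (-v) 0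

/-- The configuration of the clock with the state `(p, q)` and the tapes `clockTapes p u v`. -/
def clockConf (p q : Bool) (u v : ℕ) : clock.Conf := ((p, q), clockTapes p u v)

theorem clockTapes_same (p : Bool) (u v : ℕ) : clockTapes p u v p = seg (1 - u) 1 := if_pos rfl

theorem clock_next_second (p : Bool) (u v : ℕ) :
    clock.next (clockConf p true u v) = clockConf p false u (v + 1) := by
  refine Prod.ext rfl (funext fun x => ?_)
  simp only [next, clockConf, clock, clockTapes]
  by_cases h : x = p
  · simp [h]
  · simp only [h, if_true, if_false]
    rw [shiftTape_seg_push (by lia)]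
    congr 1; simp; lia

theorem clock_next_first (p : Bool) (u v : ℕ) :
    clock.next (clockConf p false (u + 1) v) = clockConf p true u (v + 1) := by
  have h0 : (clockTapes p (u + 1) v p 0).isSome = true := by
    rw [clockTapes_same, seg_some (by push_cast; lia) (by lia)]; rfl
  unfold next clockConf
  simp only [clock, h0, if_true, Bool.false_eq_true, if_false]
  refine Prod.ext rfl (funext fun x => ?_)
  simp only [clockTapes]
  by_cases h : x = p
  · simp only [h, if_true]
    rw [shiftTape_seg_pop]
    congr 1; simp; lia
  · simp only [h, if_false]
    rw [shiftTape_seg_push (by lia)]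
    congr 1; simp; lia

/-- The head of the filled tape stands just behind its ones. Writing one more there puts the tape
into the form of a tape to be emptied; this is the extra `1`. -/
theorem clock_next_tick (p : Bool) (v : ℕ) :
    clock.next (clockConf p false 0 v) = clockConf (!p) false (v + 1) 0 := by
  have h0 : (clockTapes p 0 v p 0).isSome = false := by
    rw [clockTapes_same, seg_none (by simp)]; rfl
  unfold next clockConf
  simp only [clock, h0, Bool.false_eq_true, if_false]
  refine Prod.ext rfl (funext fun x => ?_)
  simp only [clockTapes]
  by_cases h : x = p
  · subst h
    have hx : ¬ x = !x := by cases x <;> decide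
    rw [if_pos rfl, if_pos rfl, if_neg hx]
    rw [shiftTape_seg]
    rw [seg_of_le (by simp), seg_of_le (by simp)]
  · have h2 : x = !p := by revert h; cases x <;> cases p <;> decide
    rw [if_neg h, if_neg h, if_pos h2, shiftTape_seg_push (by lia)]
    congr 1; simp

theorem clock_tickAt (p q : Bool) (u v : ℕ) :
    clock.TickAt (clockConf p q u v) ↔ q = false ∧ u = 0 := by
  simp only [TickAt, clockConf, clock, clockTapes_same, Bool.and_eq_true, Bool.not_eq_true',
    seg]
  rcases u with _ | u
  · simp
  · simp

/-- The sum `2u + v + q` is constant between ticks, since each unit taken from `u` pays for two in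
`v`, with `q` recording the half that is still due. At a tick `(0, v)` becomes `(v + 1, 0)`, which
doubles the sum plus `2`. The bound on `v` holds because `v` grows by at most one per step. -/
theorem clock_conf (s : ℕ) : ∃ (p q : Bool) (u v : ℕ),
    clock.conf s = clockConf p q u v ∧
      2 * u + v + q.toNat + 2 = 2 ^ (Nat.count clock.Ticks s + 1) ∧ v ≤ s := by
  induction s with
  | zero =>
    refine ⟨false, false, 0, 0, Prod.ext rfl (funext fun x => ?_), by simp, le_rfl⟩
    simp only [clockConf, clockTapes]
    split_ifs
    · rw [seg_of_le (by simp)]; rfl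
    · rw [seg_of_le (by simp)]; rfl
  | succ s ih =>
    obtain ⟨p, q, u, v, hc, hu, hv⟩ := ih
    have ht : clock.Ticks s ↔ q = false ∧ u = 0 := by
      unfold Ticks; rw [hc]; exact clock_tickAt p q u v
    rw [conf_succ, hc, Nat.count_succ]
    cases q
    · rcases u with _ | u
      · rw [if_pos (ht.2 ⟨rfl, rfl⟩)]
        refine ⟨_, _, _, _, clock_next_tick p v, ?_, Nat.zero_le _⟩
        rw [pow_succ, ← hu]
        simp
        ring
      · rw [if_neg (by simp [ht])]
        refine ⟨_, _, _, _, clock_next_first p u v, ?_, by lia⟩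
        rw [add_zero, ← hu]
        simp
        ring
    · rw [if_neg (by simp [ht])]
      refine ⟨_, _, _, _, clock_next_second p u v, ?_, by lia⟩
      rw [add_zero, ← hu]
      simp
      ring

/-- The `k`-th tick of the clock is not before time `2 ^ k - 1`. -/
theorem clock_slow {s : ℕ} (h : clock.Ticks s) : 2 ^ Nat.count clock.Ticks s ≤ s + 1 := by
  obtain ⟨p, q, u, v, hc, hu, hv⟩ := clock_conf s
  unfold Ticks at h
  rw [hc, clock_tickAt] at h
  obtain ⟨rfl, rfl⟩ := h
  rw [pow_succ] at hu
  simp at hu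
  lia

theorem clock_infinite : {s | clock.Ticks s}.Infinite := by
  -- `2u + q` is the number of steps left until the next tick.
  have key : ∀ n s p (q : Bool) u v, clock.conf s = clockConf p q u v →
      2 * u + q.toNat = n → ∃ s' ≥ s, clock.Ticks s' := fun n => by
    induction n with
    | zero =>
      intro s p q u v hc hn
      refine ⟨s, le_rfl, ?_⟩
      unfold Ticks
      rw [hc, clock_tickAt]
      cases q <;> simp_all
    | succ n ih =>
      intro s p q u v hc hn
      cases q
      · rcases u with _ | u
        · simp at hn
        · obtain ⟨s', h1, h2⟩ := ih (s + 1) p true u (v + 1)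
            (by rw [conf_succ, hc]; exact clock_next_first p u v) (by simp at hn ⊢; lia)
          exact ⟨s', by lia, h2⟩
      · obtain ⟨s', h1, h2⟩ := ih (s + 1) p false u (v + 1)
          (by rw [conf_succ, hc, clock_next_second]) (by simp at hn ⊢; lia)
        exact ⟨s', by lia, h2⟩
  rw [Set.infinite_iff_exists_gt]
  intro N
  obtain ⟨p, q, u, v, hc, -, -⟩ := clock_conf (N + 1)
  obtain ⟨s', h1, h2⟩ := key _ _ _ _ _ _ hc rfl
  exact ⟨s', h2, h1⟩

/-- The machine `E` with doubly exponentially growing pauses between its steps. -/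
def slow (E : Auto κ) : Auto (Bool ⊕ Bool ⊕ κ) := clock.drive (clock.drive E)

theorem slow_infinite {E : Auto κ} (hE : {s | E.Ticks s}.Infinite) :
    {s | E.slow.Ticks s}.Infinite :=
  drive_infinite clock_infinite (drive_infinite clock_infinite hE)

/-- Here `e` is the local time of `E`. The inner clock is then at least at time `2 ^ e - 1`, and
applying `clock_slow` again to the outer clock gives the second exponential. -/
theorem slow_ticks {E : Auto κ} {s : ℕ} (h : E.slow.Ticks s) :
    ∃ e, E.Ticks e ∧ Nat.count E.Ticks e = Nat.count E.slow.Ticks s ∧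
      2 ^ (2 ^ e - 1) ≤ s + 1 := by
  obtain ⟨h1, h2⟩ := (drive_ticks _ _ _).1 h
  obtain ⟨h3, h4⟩ := (drive_ticks _ _ _).1 h2
  refine ⟨_, h4, ?_, ?_⟩
  · rw [slow, count_drive_ticks, count_drive_ticks]
  · refine le_trans (Nat.pow_le_pow_right (by norm_num) ?_) (clock_slow h1)
    have := clock_slow h3
    lia

end Auto

/-! ### Configurations of machines seen from the heads -/

def Config.view {M : Machine} (c : Config M) : TapeName M.k → TapeContent :=
  fun x i => c.tape x (c.head x + i)

theorem Config.view_zero {M : Machine} (c : Config M) (x : TapeName M.k) :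
    c.view x 0 = c.tape x (c.head x) := by
  simp [Config.view]

namespace Machine

theorem action_eq_view (M : Machine) (c : Config M) :
    M.action c = M.δ c.state fun x => c.view x 0 := by
  simp [action, Config.view]

theorem view_update {M : Machine} (c : Config M) (next : M.Q)
    (op : TapeName M.k → Option Bool × SignType) (x : TapeName M.k) :
    Config.view (M := M) ⟨next, fun j => Function.update (c.tape j) (c.head j) (op j).1,
      fun j => c.head j + ((op j).2 : ℤ)⟩ x = shiftTape (op x) (c.view x) := by
  funext i
  simp only [Config.view, shiftTape, Function.update_apply, add_assoc]
  by_cases h : i + ((op x).2 : ℤ) = 0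
  · rw [if_pos h, if_pos (by lia)]
  · rw [if_neg h, if_neg (by lia), add_comm i]

theorem step_of_act {M : Machine} {Z : BinSeq} {c : Config M} {next : M.Q}
    {op : TapeName M.k → Option Bool × SignType} (h : M.action c = .act next op) :
    (M.step Z c).state = next ∧ (M.step Z c).view = fun x => shiftTape (op x) (c.view x) := by
  unfold step
  rw [h]
  exact ⟨rfl, funext fun x => view_update c next op x⟩

theorem run_of_halted {M : Machine} {Z : BinSeq} {w : List Bool} {h T : ℕ}
    (hh : M.Halted (M.run Z w h)) (hT : h ≤ T) : M.run Z w T = M.run Z w h := by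
  induction T, hT using Nat.le_induction with
  | base => rfl
  | succ T _ ih =>
    rw [run_succ, ih]
    unfold step
    rw [hh]

end Machine

namespace Auto

variable {ι : Type}

/-- In `n` steps, `D` gets from `c` to `c'`, and it does not tick before `c'`. -/
def Reach (D : Auto ι) (n : ℕ) (c c' : D.Conf) : Prop :=
  D.next^[n] c = c' ∧ ∀ m < n, ¬ D.TickAt (D.next^[m] c)

theorem Reach.refl (D : Auto ι) (c : D.Conf) : D.Reach 0 c c := ⟨rfl, by simp⟩

theorem Reach.trans {D : Auto ι} {m n : ℕ} {c c' c'' : D.Conf} (h : D.Reach m c c')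
    (h' : D.Reach n c' c'') : D.Reach (m + n) c c'' := by
  refine ⟨by rw [add_comm, Function.iterate_add_apply, h.1, h'.1], fun k hk => ?_⟩
  rcases lt_or_ge k m with hkm | hkm
  · exact h.2 k hkm
  · obtain ⟨l, rfl⟩ := Nat.exists_eq_add_of_le hkm
    rw [add_comm, Function.iterate_add_apply, h.1]
    exact h'.2 l (by lia)

theorem Reach.of_next {D : Auto ι} {c c' : D.Conf} (h : D.next c = c') (ht : ¬ D.TickAt c) :
    D.Reach 1 c c' := by
  refine ⟨h, fun m hm => ?_⟩
  obtain rfl : m = 0 := by lia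
  exact ht

/-- If a machine ticks infinitely often, passing through `c j` after the `j`-th tick, then it ticks
after `n j` further steps. -/
theorem ticks_of_reach (D : Auto ι) (c : ℕ → D.Conf) (n : ℕ → ℕ) (h0 : c 0 = D.conf 0)
    (hr : ∀ j, ∃ c', D.Reach (n j) (c j) c' ∧ D.TickAt c' ∧ D.next c' = c (j + 1)) :
    {s | D.Ticks s}.Infinite ∧ ∀ s, D.Ticks s → n (Nat.count D.Ticks s) ≤ s := by
  have hadd : ∀ s m, D.conf (s + m) = D.next^[m] (D.conf s) := fun s m => by
    unfold conf; rw [add_comm, Function.iterate_add_apply]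
  have step : ∀ j s, D.conf s = c j → D.Ticks (s + n j) ∧ D.conf (s + n j + 1) = c (j + 1) ∧
      ∀ m < n j, ¬ D.Ticks (s + m) := fun j s hs => by
    obtain ⟨c', h1, h2, h3⟩ := hr j
    have hc' : D.conf (s + n j) = c' := by rw [hadd, hs, h1.1]
    refine ⟨?_, by rw [conf_succ, hc', h3], fun m hm => ?_⟩
    · unfold Ticks; rw [hc']; exact h2
    · unfold Ticks; rw [hadd, hs]; exact h1.2 m hm
  -- The configuration `c j` is met at a time before which there have been exactly `j` ticks.
  have start : ∀ j, ∃ s, D.conf s = c j ∧ Nat.count D.Ticks s = j := fun j => by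
    induction j with
    | zero => exact ⟨0, h0.symm, by simp⟩
    | succ j ih =>
      obtain ⟨s, h1, h2⟩ := ih
      obtain ⟨h3, h4, h5⟩ := step j s h1
      refine ⟨s + n j + 1, h4, ?_⟩
      rw [Nat.count_succ, if_pos h3, Nat.count_add, h2, Nat.add_right_cancel_iff,
        Nat.add_eq_left, Nat.count_iff_forall_not]
      exact fun m hm => h5 m hm
  constructor
  · rw [Set.infinite_iff_exists_gt]
    intro N
    obtain ⟨s, h1, h2⟩ := start (N + 1)
    refine ⟨s + n (N + 1), (step _ s h1).1, ?_⟩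
    have := Nat.count_le (p := D.Ticks) (n := s)
    lia
  · intro s hs
    obtain ⟨r, h1, h2⟩ := start (Nat.count D.Ticks s)
    obtain ⟨h3, h4, h5⟩ := step _ r h1
    have hrs : r ≤ s := by
      by_contra! h
      have := Nat.count_strict_mono hs h
      lia
    by_contra! h
    exact h5 (s - r) (by lia) (by rwa [Nat.add_sub_cancel' hrs])

end Auto

/-! ### Running a machine on all unary inputs -/

/-- The states of the machine that runs a machine with states `Q` on `1ʲ` for `j = 0, 1, …`: it
copies the input, takes the heads back, simulates, and clears the tapes by sweeping over them. -/
inductive StageState (Q : Type) : Type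
  | copy
  | back
  | sim (q : Q)
  | sweepLeft
  | sweepRight
  | sweepBack

def stageStateEquiv (Q : Type) : StageState Q ≃ Fin 5 ⊕ Q where
  toFun
    | .copy => .inl 0
    | .back => .inl 1
    | .sweepLeft => .inl 2
    | .sweepRight => .inl 3
    | .sweepBack => .inl 4
    | .sim q => .inr q
  invFun
    | .inl 0 => .copy
    | .inl 1 => .back
    | .inl 2 => .sweepLeft
    | .inl 3 => .sweepRight
    | .inl 4 => .sweepBack
    | .inr q => .sim q
  left_inv x := by cases x <;> rfl
  right_inv x := by
    rcases x with x | x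
    · fin_cases x <;> rfl
    · rfl

/-- Tape operations that act on the input tape only. -/
def inputOp {k : ℕ} (o : Option Bool × SignType) (v : TapeName k → Option Bool) :
    TapeName k → Option Bool × SignType
  | .input => o
  | x => (v x, 0)

/-- The tapes that are blank except for the input tape. -/
def inputTapes {k : ℕ} (T : TapeContent) : TapeName k → TapeContent
  | .input => T
  | _ => fun _ => none

/-- The transition function, for the symbols `j` on the tape that carries the current input, `s` on
the tape that counts steps, and `v` on the tapes of `M`. -/
def stageStep (M : Machine) (q : StageState M.Q) (j s : Option Bool)
    (v : TapeName M.k → Option Bool) : StageState M.Q × (Option Bool × SignType) ×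
      (Option Bool × SignType) × (TapeName M.k → Option Bool × SignType) :=
  match q with
  | .copy =>
    if j.isSome then (.copy, (j, 1), (some true, 1), inputOp (some true, 1) v)
    else (.back, (some true, -1), (some true, 1), inputOp (v .input, -1) v)
  | .back =>
    if j.isSome then (.back, (j, -1), (some true, 1), inputOp (v .input, -1) v)
    else (.sim M.start, (j, 1), (some true, 1), inputOp (v .input, 1) v)
  | .sim q =>
    match M.δ q v with
    | .act next op => (.sim next, (j, 0), (some true, 1), op)
    | _ => (.sweepLeft, (j, 0), (s, -1), fun x => (v x, 0))
  | .sweepLeft =>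
    if s.isSome then (.sweepLeft, (j, 0), (s, -1), fun _ => (none, -1))
    else (.sweepRight, (j, 0), (s, 1), fun _ => (none, 0))
  | .sweepRight =>
    if s.isSome then (.sweepRight, (j, 0), (s, 1), fun _ => (none, 1))
    else (.sweepBack, (j, 0), (s, -1), fun _ => (none, 0))
  | .sweepBack =>
    if s.isSome then (.sweepBack, (j, 0), (none, -1), fun _ => (none, 1))
    else (.copy, (j, 0), (s, 0), fun _ => (none, 0))

/-- The machine that runs `M` on `1ʲ` for `j = 0, 1, …` and ticks after each of these runs. -/
def stages (M : Machine) : Auto (Bool ⊕ TapeName M.k) where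
  Q := StageState M.Q
  finite_states := by
    have := M.finite_states
    exact Finite.of_equiv _ (stageStateEquiv M.Q).symm
  start := .copy
  δ q r :=
    let a := stageStep M q (r (.inl true)) (r (.inl false)) fun x => r (.inr x)
    (a.1, Sum.elim (fun b => bif b then a.2.1 else a.2.2.1) a.2.2.2)
  tick q r :=
    match q with
    | .sweepBack => !(r (.inl false)).isSome
    | _ => false

section Stages

variable (M : Machine)

def stageConf (q : StageState M.Q) (J S : TapeContent) (V : TapeName M.k → TapeContent) :
    (stages M).Conf :=
  (q, Sum.elim (fun b => bif b then J else S) V)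

variable {M}

theorem stages_next {q q' : StageState M.Q} {J S : TapeContent} {V : TapeName M.k → TapeContent}
    {oj os : Option Bool × SignType} {ov : TapeName M.k → Option Bool × SignType}
    (h : stageStep M q (J 0) (S 0) (fun x => V x 0) = (q', oj, os, ov)) :
    (stages M).next (stageConf M q J S V) =
      stageConf M q' (shiftTape oj J) (shiftTape os S) fun x => shiftTape (ov x) (V x) := by
  have h' : stageStep M q (bif true then J 0 else S 0) (bif false then J 0 else S 0)
      (fun x => V x 0) = (q', oj, os, ov) := h
  simp only [Auto.next, stages, stageConf, Sum.elim_inl, Sum.elim_inr, cond_true, cond_false, h]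
  refine Prod.ext rfl (funext fun x => ?_)
  rcases x with (_ | _) | x <;> rfl

theorem stages_reach {q q' : StageState M.Q} {J S J' S' : TapeContent}
    {V V' : TapeName M.k → TapeContent} (oj os : Option Bool × SignType)
    (ov : TapeName M.k → Option Bool × SignType)
    (h : stageStep M q (J 0) (S 0) (fun x => V x 0) = (q', oj, os, ov))
    (hq : q = .sweepBack → (S 0).isSome) (hJ : shiftTape oj J = J') (hS : shiftTape os S = S')
    (hV : (fun x => shiftTape (ov x) (V x)) = V') :
    (stages M).Reach 1 (stageConf M q J S V) (stageConf M q' J' S' V') := by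
  subst hJ hS hV
  refine Auto.Reach.of_next (stages_next h) fun ht => ?_
  cases q with
  | sweepBack =>
    have := hq rfl
    simp [Auto.TickAt, stages, stageConf] at ht
    simp [ht] at this
  | _ => simp [Auto.TickAt, stages, stageConf] at ht

theorem shiftTape_seg_eq {a b a' b' : ℤ} {m : SignType} (ha : a - m = a') (hb : b - m = b') :
    shiftTape (seg a b 0, m) (seg a b) = seg a' b' := by
  rw [shiftTape_seg, ha, hb]

theorem shiftTape_push_eq {a b a' b' : ℤ} {m : SignType} (hab : a ≤ 0) (h0 : b = 0)
    (ha : a - m = a') (hb : 1 - m = b') : shiftTape (some true, m) (seg a b) = seg a' b' := by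
  rw [h0, shiftTape_seg_push hab, ha, hb]

theorem shiftTape_inputOp (o : Option Bool × SignType) (T : TapeContent) :
    (fun x : TapeName M.k => shiftTape (inputOp o (fun y => inputTapes T y 0) x) (inputTapes T x)) =
      inputTapes (shiftTape o T) := by
  funext x
  cases x
  · rfl
  all_goals exact shiftTape_idle _

theorem shiftTape_inputOp_eq {o : Option Bool × SignType} {T T' : TapeContent}
    (h : shiftTape o T = T') :
    (fun x : TapeName M.k => shiftTape (inputOp o (fun y => inputTapes T y 0) x) (inputTapes T x)) =
      inputTapes T' := by
  rw [shiftTape_inputOp, h]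

/-! ### The phases of one stage: copying, simulating, clearing -/

theorem reach_copy (j p : ℕ) (hp : p ≤ j) :
    (stages M).Reach p (stageConf M .copy (seg 0 j) (seg 0 0) (inputTapes (seg 0 0)))
      (stageConf M .copy (seg (-p) (j - p)) (seg (-p) 0) (inputTapes (seg (-p) 0))) := by
  induction p with
  | zero => simpa using Auto.Reach.refl _ _
  | succ p ih =>
    have h0 : seg (-p) (j - p) 0 = some true := seg_some (by lia) (by lia)
    exact (ih (by lia)).trans (stages_reach (seg (-p) (j - p) 0, 1) (some true, 1)
      (inputOp (some true, 1) fun y => inputTapes (seg (-p) 0) y 0)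
      (by simp [stageStep, h0]) (by simp) (shiftTape_seg_eq (by simp; lia) (by simp; lia))
      (shiftTape_push_eq (by lia) rfl (by simp; lia) (by simp))
      (shiftTape_inputOp_eq (shiftTape_push_eq (by lia) rfl (by simp; lia) (by simp))))

theorem reach_back (j r : ℕ) (hr : r ≤ j) :
    (stages M).Reach r
      (stageConf M .back (seg (1 - j) 2) (seg (-(j + 1)) 0) (inputTapes (seg (1 - j) 1)))
      (stageConf M .back (seg (1 - j + r) (2 + r)) (seg (-(j + 1 + r)) 0)
        (inputTapes (seg (1 - j + r) (1 + r)))) := by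
  induction r with
  | zero => simpa using Auto.Reach.refl _ _
  | succ r ih =>
    have h0 : seg (1 - j + r) (2 + r) 0 = some true := seg_some (by lia) (by lia)
    exact (ih (by lia)).trans (stages_reach (seg (1 - j + r) (2 + r) 0, -1) (some true, 1)
      (inputOp (seg (1 - j + r) (1 + r) 0, -1) fun y => inputTapes (seg (1 - j + r) (1 + r)) y 0)
      (by simp [stageStep, h0, inputTapes]) (by simp)
      (shiftTape_seg_eq (by simp; lia) (by simp; lia))
      (shiftTape_push_eq (by lia) rfl (by simp; lia) (by simp))
      (shiftTape_inputOp_eq (shiftTape_seg_eq (by simp; lia) (by simp; lia))))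

/-- At the end of copying a one is appended to the stored input, which is thus ready for the next
stage while `M` is run on `1ʲ`. The step counter has already gained one mark for each of the `2j +
2` steps. -/
theorem reach_sim_start (j : ℕ) :
    (stages M).Reach (j + 1 + j + 1)
      (stageConf M .copy (seg 0 j) (seg 0 0) (inputTapes (seg 0 0)))
      (stageConf M (.sim M.start) (seg 0 (j + 1)) (seg (-(2 * j + 2 : ℕ)) 0)
        (inputTapes (seg 0 j))) := by
  have hn : seg (-j) (j - j) 0 = none := seg_none (by lia)
  have hn' : seg (1 - j + j) (2 + j) 0 = none := seg_none (by lia)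
  refine (((reach_copy j j le_rfl).trans (stages_reach (some true, -1) (some true, 1)
    (inputOp (seg (-j) 0 0, -1) fun y => inputTapes (seg (-j) 0) y 0) ?_ (by simp)
    (shiftTape_push_eq (by lia) (by lia) (by simp; lia) (by simp))
    (shiftTape_push_eq (by lia) rfl (by simp; lia) (by simp))
    (shiftTape_inputOp_eq (shiftTape_seg_eq (by simp; lia) (by simp))))).trans
    (reach_back j j le_rfl)).trans (stages_reach (seg (1 - j + j) (2 + j) 0, 1) (some true, 1)
    (inputOp (seg (1 - j + j) (1 + j) 0, 1) fun y => inputTapes (seg (1 - j + j) (1 + j)) y 0)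
    ?_ (by simp) (shiftTape_seg_eq (by simp) (by simp; lia))
    (shiftTape_push_eq (by lia) rfl (by simp; lia) (by simp))
    (shiftTape_inputOp_eq (shiftTape_seg_eq (by simp) (by simp))))
  · simp only [stageStep, hn]; rfl
  · simp only [stageStep, hn']; rfl

/-- The tape is blank outside the cells `lo, …, hi`. -/
def SupportedIn (lo hi : ℤ) (T : TapeContent) : Prop := ∀ i, T i ≠ none → lo ≤ i ∧ i ≤ hi

theorem SupportedIn.shift {lo hi : ℤ} {T : TapeContent} (h : SupportedIn lo hi T) (hlo : lo ≤ 0)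
    (hhi : 0 ≤ hi) (op : Option Bool × SignType) :
    SupportedIn (lo - 1) (hi + 1) (shiftTape op T) := by
  intro i hi'
  simp only [shiftTape, Function.update_apply] at hi'
  have : ((op.2 : ℤ) = -1 ∨ (op.2 : ℤ) = 0 ∨ (op.2 : ℤ) = 1) := by
    cases op.2 <;> simp
  split_ifs at hi' with h0
  · lia
  · have := h _ hi'
    lia

theorem SupportedIn.erase {lo hi : ℤ} {T : TapeContent} (h : SupportedIn lo hi T) (m : SignType) :
    SupportedIn (lo - m) (hi - m) (shiftTape (none, m) T) := by
  intro i hi'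
  simp only [shiftTape, Function.update_apply] at hi'
  split_ifs at hi' with h0
  · simp at hi'
  · have := h _ hi'
    lia

/-- The cell under the head is erased before the head leaves it, so nothing remains to the left. -/
theorem SupportedIn.erase_right {hi : ℤ} {T : TapeContent} (h : SupportedIn 0 hi T) :
    SupportedIn 0 (hi - 1) (shiftTape (none, 1) T) := by
  intro i hi'
  simp only [shiftTape, Function.update_apply, SignType.coe_one] at hi'
  split_ifs at hi' with h0
  · simp at hi'
  · have := h _ hi'
    lia

theorem init_view (M : Machine) (j : ℕ) :
    (M.init (List.replicate j true)).view = inputTapes (seg 0 j) := by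
  funext x i
  cases x
  · simp only [Config.view, Machine.init, inputTapes, tapeOf, seg, zero_add]
    by_cases h : 0 ≤ i
    · rw [if_pos h, List.getElem?_replicate]
      congr 1
      simp only [eq_iff_iff]
      lia
    · rw [if_neg h, if_neg (by lia)]
  all_goals rfl

/-- The counter gains a mark with every step, so its length bounds the distance from the heads to
all nonblank cells, in both directions. The clearing phase relies on this. -/
theorem reach_sim (hM : M.OracleFree) (Z : BinSeq) (j n : ℕ)
    (hn : ∀ m < n, ¬ M.Halted (M.run Z (List.replicate j true) m)) :
    (stages M).Reach n
      (stageConf M (.sim M.start) (seg 0 (j + 1)) (seg (-(2 * j + 2 : ℕ)) 0)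
        (inputTapes (seg 0 j)))
      (stageConf M (.sim (M.run Z (List.replicate j true) n).state) (seg 0 (j + 1))
        (seg (-(2 * j + 2 + n : ℕ)) 0) (M.run Z (List.replicate j true) n).view) ∧
    ∀ x, SupportedIn (-(2 * j + 2 + n : ℕ)) (2 * j + 2 + n : ℕ)
      ((M.run Z (List.replicate j true) n).view x) := by
  induction n with
  | zero =>
    have : (M.run Z (List.replicate j true) 0).view = inputTapes (seg 0 j) := init_view M j
    rw [this]
    refine ⟨Auto.Reach.refl _ _, fun x i hi => ?_⟩
    cases x <;> simp [inputTapes, seg] at hi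
    push_cast
    lia
  | succ n ih =>
    obtain ⟨h1, h2⟩ := ih fun m hm => hn m (by lia)
    have h3 := hn n (by lia)
    rw [Machine.run_succ]
    generalize M.run Z (List.replicate j true) n = c at h1 h2 h3
    unfold Machine.Halted at h3
    rcases ha : M.action c with _ | next | ⟨q, op⟩
    · exact absurd ha h3
    · exact absurd ha (hM _ _ _)
    · obtain ⟨h4, h5⟩ := Machine.step_of_act (Z := Z) ha
      rw [h4, h5]
      refine ⟨h1.trans ?_, fun x i hi => ?_⟩
      · rw [Machine.action_eq_view] at ha
        exact stages_reach (seg 0 (j + 1) 0, 0) (some true, 1) op (by simp only [stageStep, ha])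
          (by simp) (shiftTape_idle _)
          (shiftTape_push_eq (by lia) rfl (by push_cast; simp; lia) (by simp)) rfl
      · have := (h2 x).shift (by lia) (by lia) (op x) i hi
        push_cast at this ⊢
        lia

/-- After `c` moves to the left everything nonblank lies in the cells `0, …, 2c` as seen from the
heads. -/
theorem reach_sweepLeft (J : TapeContent) (c r : ℕ) (hr : r ≤ c) (V : TapeName M.k → TapeContent)
    (hV : ∀ x, SupportedIn (-c) c (V x)) :
    ∃ V', (∀ x, SupportedIn (-c + r) (c + r) (V' x)) ∧
      (stages M).Reach r (stageConf M .sweepLeft J (seg (1 - c) 1) V)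
        (stageConf M .sweepLeft J (seg (1 - c + r) (1 + r)) V') := by
  induction r with
  | zero => exact ⟨V, by simpa using hV, by simpa using Auto.Reach.refl _ _⟩
  | succ r ih =>
    obtain ⟨V', h1, h2⟩ := ih (by lia)
    have h0 : seg (1 - c + r) (1 + r) 0 = some true := seg_some (by lia) (by lia)
    refine ⟨fun x => shiftTape (none, -1) (V' x), fun x i hi => ?_, h2.trans ?_⟩
    · have := (h1 x).erase (-1) i hi
      simp at this ⊢
      lia
    · exact stages_reach (J 0, 0) (seg (1 - c + r) (1 + r) 0, -1) (fun _ => (none, -1))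
        (by simp [stageStep, h0]) (by simp) (shiftTape_idle _)
        (shiftTape_seg_eq (by simp; lia) (by simp; lia)) rfl

theorem reach_sweepRight (J : TapeContent) (c r : ℕ) (hr : r ≤ c) (V : TapeName M.k → TapeContent)
    (hV : ∀ x, SupportedIn 0 (2 * c) (V x)) :
    ∃ V', (∀ x, SupportedIn 0 (2 * c - r) (V' x)) ∧
      (stages M).Reach r (stageConf M .sweepRight J (seg 0 c) V)
        (stageConf M .sweepRight J (seg (-r) (c - r)) V') := by
  induction r with
  | zero => exact ⟨V, by simpa using hV, by simpa using Auto.Reach.refl _ _⟩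
  | succ r ih =>
    obtain ⟨V', h1, h2⟩ := ih (by lia)
    have h0 : seg (-r) (c - r) 0 = some true := seg_some (by lia) (by lia)
    refine ⟨fun x => shiftTape (none, 1) (V' x), fun x i hi => ?_, h2.trans ?_⟩
    · have := (h1 x).erase_right i hi
      push_cast
      lia
    · exact stages_reach (J 0, 0) (seg (-r) (c - r) 0, 1) (fun _ => (none, 1))
        (by simp [stageStep, h0]) (by simp) (shiftTape_idle _)
        (shiftTape_seg_eq (by simp; lia) (by simp; lia)) rfl

/-- The counter has only `c` marks, but `2c` cells must be cleared. While the counter is read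
backwards and erased, the other heads go on to the right and clear the second half. -/
theorem reach_sweepBack (J : TapeContent) (c r : ℕ) (hr : r ≤ c) (V : TapeName M.k → TapeContent)
    (hV : ∀ x, SupportedIn 0 c (V x)) :
    ∃ V', (∀ x, SupportedIn 0 (c - r) (V' x)) ∧
      (stages M).Reach r (stageConf M .sweepBack J (seg (1 - c) 1) V)
        (stageConf M .sweepBack J (seg (1 - c + r) 1) V') := by
  induction r with
  | zero => exact ⟨V, by simpa using hV, by simpa using Auto.Reach.refl _ _⟩
  | succ r ih =>
    obtain ⟨V', h1, h2⟩ := ih (by lia)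
    have h0 : seg (1 - c + r) 1 0 = some true := seg_some (by lia) (by lia)
    refine ⟨fun x => shiftTape (none, 1) (V' x), fun x i hi => ?_, h2.trans ?_⟩
    · have := (h1 x).erase_right i hi
      push_cast
      lia
    · refine stages_reach (J 0, 0) (none, -1) (fun _ => (none, 1))
        (by simp [stageStep, h0]) (by simp [h0]) (shiftTape_idle _) ?_ rfl
      rw [shiftTape_seg_pop]
      congr 1
      simp; lia

/-- The tapes get cleared. -/
theorem reach_clear (J : TapeContent) (c : ℕ) (V : TapeName M.k → TapeContent)
    (hV : ∀ x, SupportedIn (-c) c (V x)) :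
    ∃ n c', (stages M).Reach n (stageConf M .sweepLeft J (seg (1 - c) 1) V) c' ∧
      (stages M).TickAt c' ∧
      (stages M).next c' = stageConf M .copy J (seg 0 0) (inputTapes (seg 0 0)) := by
  obtain ⟨V₁, h1, r1⟩ := reach_sweepLeft J c c le_rfl V hV
  have t1 := stages_reach (M := M) (q := .sweepLeft) (q' := .sweepRight) (J := J) (V := V₁)
    (S := seg (1 - c + c) (1 + c)) (S' := seg 0 c) (J 0, 0) (seg (1 - c + c) (1 + c) 0, 1)
    (fun _ => (none, 0)) (by simp [stageStep, seg]) (by simp) (shiftTape_idle _)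
    (shiftTape_seg_eq (by simp) (by simp)) rfl
  obtain ⟨V₂, h2, r2⟩ := reach_sweepRight (M := M) J c c le_rfl
    (fun x => shiftTape (none, 0) (V₁ x)) fun x i hi => by
      have := (h1 x).erase 0 i hi
      simp at this ⊢
      lia
  have t2 := stages_reach (M := M) (q := .sweepRight) (q' := .sweepBack) (J := J) (V := V₂)
    (S := seg (-c) (c - c)) (S' := seg (1 - c) 1) (J 0, 0) (seg (-c) (c - c) 0, -1)
    (fun _ => (none, 0)) (by simp [stageStep, seg]) (by simp) (shiftTape_idle _)
    (shiftTape_seg_eq (by simp; lia) (by simp)) rfl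
  obtain ⟨V₃, h3, r3⟩ := reach_sweepBack (M := M) J c c le_rfl
    (fun x => shiftTape (none, 0) (V₂ x)) fun x i hi => by
      have := (h2 x).erase 0 i hi
      simp at this ⊢
      lia
  refine ⟨_, _, (((r1.trans t1).trans r2).trans t2).trans r3, ?_, ?_⟩
  · simp [Auto.TickAt, stages, stageConf, seg]
  · rw [stages_next (q' := .copy) (oj := (J 0, 0)) (os := (seg (1 - c + c) 1 0, 0))
      (ov := fun _ => (none, 0)) (by simp [stageStep, seg]), shiftTape_idle, shiftTape_idle]
    congr 1
    · rw [seg_of_le (by lia), seg_of_le le_rfl]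
    · funext x i
      have hb : (inputTapes (seg 0 0) x : TapeContent) i = none := by
        cases x <;> simp [inputTapes, seg]
      rw [hb]
      simp only [shiftTape, Function.update_apply, SignType.coe_zero, add_zero]
      split_ifs with h
      · rfl
      -- Only cell `0` could still be nonblank, and the ticking step erases it.
      · by_contra hne
        have := h3 x i hne
        lia

theorem reach_stage (hM : M.OracleFree) (Z : BinSeq) (j h : ℕ)
    (hh : M.Halted (M.run Z (List.replicate j true) h))
    (hn : ∀ m < h, ¬ M.Halted (M.run Z (List.replicate j true) m)) :
    ∃ n c', h ≤ n ∧
      (stages M).Reach n (stageConf M .copy (seg 0 j) (seg 0 0) (inputTapes (seg 0 0))) c' ∧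
      (stages M).TickAt c' ∧
      (stages M).next c' =
        stageConf M .copy (seg 0 (j + 1 : ℕ)) (seg 0 0) (inputTapes (seg 0 0)) := by
  have r1 := reach_sim_start (M := M) j
  obtain ⟨r2, hV⟩ := reach_sim hM Z j h hn
  generalize M.run Z (List.replicate j true) h = c at hh r2 hV
  have ha : M.δ c.state (fun x => c.view x 0) = .halt := by rw [← Machine.action_eq_view]; exact hh
  obtain ⟨n, c', r4, h4, h5⟩ := reach_clear (M := M) (seg 0 (j + 1)) (2 * j + 2 + h) c.view hV
  have r3 := stages_reach (M := M) (q := .sim c.state) (q' := .sweepLeft) (J := seg 0 (j + 1))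
    (S := seg (-(2 * j + 2 + h : ℕ)) 0) (S' := seg (1 - (2 * j + 2 + h : ℕ)) 1) (V := c.view)
    (seg 0 (j + 1) 0, 0) (seg (-(2 * j + 2 + h : ℕ)) 0 0, -1) (fun x => (c.view x 0, 0))
    (by simp only [stageStep, ha]) (by simp) (shiftTape_idle _)
    (shiftTape_seg_eq (by simp; lia) (by simp)) (funext fun _ => shiftTape_idle _)
  refine ⟨_, c', ?_, ((r1.trans r2).trans r3).trans r4, h4, ?_⟩
  · lia
  · rw [h5]; push_cast; rfl

end Stages

/-- If `t` is time-constructible, some machine ticks infinitely often, but not for the `j`-th time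
before the time `t j`. -/
theorem TimeConstructible.exists_auto {t : ℕ → ℕ} (hc : TimeConstructible t) :
    ∃ (ι : Type) (_ : Finite ι) (E : Auto ι), {s | E.Ticks s}.Infinite ∧
      ∀ s, E.Ticks s → t (Nat.count E.Ticks s) ≤ s := by
  classical
  obtain ⟨M, hM, C, hMt⟩ := hc
  let Z : BinSeq := fun _ => false
  have hhalt : ∀ j, ∃ h, M.Halted (M.run Z (List.replicate j true) h) :=
    fun j => ⟨_, (hMt j Z).1⟩
  -- The output consists of `t j` ones, and writing them takes at least `t j` steps.
  have ht : ∀ j, t j ≤ Nat.find (hhalt j) := fun j => by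
    by_contra! hlt
    have h1 := (hMt j Z).2
    rw [Machine.run_of_halted (Nat.find_spec (hhalt j)) (Nat.find_min' _ (hMt j Z).1)] at h1
    have h2 := (M.head_le_and_blank Z (List.replicate j true) .numer 0 le_rfl (fun _ _ => rfl)
      (Nat.find (hhalt j))).2 _ (by rw [zero_add])
    rw [h1, tapeOf, if_pos (by lia), List.getElem?_replicate, if_pos (by lia)] at h2
    simp at h2
  have hstage := fun j => reach_stage hM Z j _ (Nat.find_spec (hhalt j))
    fun m hm => Nat.find_min (hhalt j) hm
  choose n hn using hstage
  have key := Auto.ticks_of_reach (stages M)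
    (fun j => stageConf M .copy (seg 0 j) (seg 0 0) (inputTapes (seg 0 0))) n ?_ ?_
  · refine ⟨_, inferInstance, stages M, key.1, fun s hs => ?_⟩
    obtain ⟨c', h1, -⟩ := hn (Nat.count (stages M).Ticks s)
    exact (ht _).trans (h1.trans (key.2 s hs))
  · refine Prod.ext rfl (funext fun x => ?_)
    rcases x with (_ | _) | x
    · exact seg_of_le le_rfl
    · exact seg_of_le le_rfl
    · cases x
      · exact seg_of_le le_rfl
      all_goals rfl
  · intro j
    obtain ⟨c', -, h2, h3, h4⟩ := hn j
    exact ⟨c', h2, h3, h4⟩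

/-! ### The martingale that succeeds on the interleaving -/

/-- At the second bit of the `p`-th pair of bits, where `D` ticks at time `p` for the `2i`-th time,
bet everything that this bit equals the first bit of the `i`-th pair. -/
def pairRatio {ι : Type} (D : Auto ι) (v : List Bool) (a : Bool) : ℝ≥0 :=
  if v.length.bodd = true ∧ D.Ticks (v.length / 2) ∧
      (Nat.count D.Ticks (v.length / 2)).bodd = false then
    if a = v.getD (Nat.count D.Ticks (v.length / 2)) false then 2 else 0
  else 1

theorem pairRatio_add {ι : Type} (D : Auto ι) (v : List Bool) :
    pairRatio D v false + pairRatio D v true = 2 := by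
  unfold pairRatio
  by_cases h : v.length.bodd = true ∧ D.Ticks (v.length / 2) ∧
      (Nat.count D.Ticks (v.length / 2)).bodd = false
  · rw [if_pos h, if_pos h]
    cases v.getD (Nat.count D.Ticks (v.length / 2)) false <;> simp
  · rw [if_neg h, if_neg h]
    norm_num

/-! ### A machine for this martingale -/

inductive ScanState (Q : Type) : Type
  | copying
  | rewinding
  | scan (odd alive par : Bool) (q : Q)
  | done

def scanStateEquiv (Q : Type) : ScanState Q ≃ Fin 3 ⊕ (Bool × Bool × Bool × Q) where
  toFun
    | .copying => .inl 0
    | .rewinding => .inl 1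
    | .done => .inl 2
    | .scan a b c q => .inr (a, b, c, q)
  invFun
    | .inl 0 => .copying
    | .inl 1 => .rewinding
    | .inl 2 => .done
    | .inr (a, b, c, q) => .scan a b c q
  left_inv x := by cases x <;> rfl
  right_inv x := by
    rcases x with x | x
    · fin_cases x <;> rfl
    · rfl

/-- What the machine does while it has not finished: the new state, the move on the input tape, the
operation on the copy of the input, whether `0` is appended to the numerator, and the operations on
the tapes of `D`. -/
structure ScanMove (ι Q : Type) where
  state : ScanState Q
  input : SignType
  copy : Option Bool × SignType
  push : Bool
  ops : ι → Option Bool × SignType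

section Scan

variable {ι : Type} (D : Auto ι)

/-- The transition function before the end, for the symbols `b` on the input tape, `a` on its copy
and `v` on the tapes of `D`. First the input is copied and the heads return; then `D` runs, with one
step for each pair of bits of the input, and the copy is advanced by one cell when `D` ticks. -/
def scanMove (q : ScanState D.Q) (b a : Option Bool) (v : ι → Option Bool) :
    Option (ScanMove ι D.Q) :=
  match q with
  | .copying =>
    if b.isSome then some ⟨.copying, 1, (b, 1), false, fun x => (v x, 0)⟩
    else some ⟨.rewinding, -1, (a, -1), false, fun x => (v x, 0)⟩
  | .rewinding =>
    if b.isSome then some ⟨.rewinding, -1, (a, -1), false, fun x => (v x, 0)⟩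
    else some ⟨.scan false true false D.start, 1, (a, 1), false, fun x => (v x, 0)⟩
  | .scan odd alive par q =>
    if b.isSome then
      if odd then
        if D.tick q v then
          some ⟨.scan false (alive && (par || a == b)) (!par) (D.δ q v).1, 1, (a, 1),
            !par && a == b, (D.δ q v).2⟩
        else some ⟨.scan false alive par (D.δ q v).1, 1, (a, 0), false, (D.δ q v).2⟩
      else some ⟨.scan true alive par q, 1, (a, 0), false, fun x => (v x, 0)⟩
    else none
  | .done => none

variable {k : ℕ} (e : Fin k ≃ Option ι)

def scanOps (m : ScanMove ι D.Q) (r : TapeName k → Option Bool) :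
    TapeName k → Option Bool × SignType
  | .input => (r .input, m.input)
  | .query => (r .query, 0)
  | .numer => if m.push then (some false, 1) else (r .numer, 0)
  | .denom => (r .denom, 0)
  | .work i =>
    match e i with
    | none => m.copy
    | some x => m.ops x

theorem scanOps_work_some (m : ScanMove ι D.Q) (r : TapeName k → Option Bool) (x : ι) :
    scanOps D e m r (.work (e.symm (some x))) = m.ops x := by
  simp [scanOps]

/-- Digits are written least significant first, so a final one behind `z` zeros yields `2 ^ z`.
After a lost bet it is omitted and the numerator has the value `0`. -/
def finishOps (alive : Bool) (r : TapeName k → Option Bool) :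
    TapeName k → Option Bool × SignType
  | .numer => (if alive then some true else r .numer, 0)
  | .denom => (some true, 0)
  | x => (r x, 0)

def scanStep (q : ScanState D.Q) (r : TapeName k → Option Bool) : Action k (ScanState D.Q) :=
  match scanMove D q (r .input) (r (.work (e.symm none))) fun x => r (.work (e.symm (some x))) with
  | some m => .act m.state (scanOps D e m r)
  | none =>
    match q with
    | .scan _ alive _ _ => .act .done (finishOps alive r)
    | _ => .halt

def scanMachine : Machine where
  k := k
  Q := ScanState D.Q
  finite_states := by
    have := D.finite_states
    exact Finite.of_equiv _ (scanStateEquiv D.Q).symm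
  start := .copying
  δ := scanStep D e

theorem scanMachine_oracleFree : (scanMachine D e).OracleFree := by
  intro q r next h
  change scanStep D e q r = _ at h
  unfold scanStep at h
  split at h
  · cases h
  · cases q <;> cases h

/-- The tape with zeros in the cells `0, …, z - 1`. -/
def zeros (z : ℕ) : TapeContent := fun i => if 0 ≤ i ∧ i < z then some false else none

theorem update_zeros (z : ℕ) : Function.update (zeros z) z (some false) = zeros (z + 1) := by
  funext i
  simp only [zeros, Function.update_apply]
  split_ifs <;> first | rfl | lia

/-- The configurations before the end: `i` and `p` are the positions of the heads on the input and
its copy, `T` is the copy, the numerator consists of `z` zeros, and `V` are the tapes of `D`. -/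
structure ScanAt (w : List Bool) (c : Config (scanMachine D e)) (q : ScanState D.Q) (i : ℤ)
    (T : TapeContent) (p : ℤ) (z : ℕ) (V : ι → TapeContent) : Prop where
  state : c.state = q
  input_tape : c.tape .input = tapeOf w
  input_head : c.head .input = i
  numer_tape : c.tape .numer = zeros z
  numer_head : c.head .numer = z
  denom_tape : c.tape .denom = fun _ => none
  denom_head : c.head .denom = 0
  copy_tape : c.tape (.work (e.symm none)) = T
  copy_head : c.head (.work (e.symm none)) = p
  view : ∀ x, c.view (.work (e.symm (some x))) = V x

variable {D e} {w : List Bool} {Z : BinSeq} {c : Config (scanMachine D e)} {q : ScanState D.Q}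
  {i p : ℤ} {T : TapeContent} {z : ℕ} {V : ι → TapeContent}

theorem ScanAt.move_eq (h : ScanAt D e w c q i T p z V) :
    scanMove D c.state (c.tape .input (c.head .input))
      (c.tape (.work (e.symm none)) (c.head (.work (e.symm none))))
      (fun x => c.tape (.work (e.symm (some x))) (c.head (.work (e.symm (some x))))) =
    scanMove D q (tapeOf w i) (T p) fun x => V x 0 := by
  rw [h.state, h.input_tape, h.input_head, h.copy_tape, h.copy_head]
  congr 1
  funext x
  rw [← h.view x]
  exact (Config.view_zero c _).symm

theorem ScanAt.step (h : ScanAt D e w c q i T p z V) {m : ScanMove ι D.Q}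
    (hm : scanMove D q (tapeOf w i) (T p) (fun x => V x 0) = some m) :
    ScanAt D e w ((scanMachine D e).step Z c) m.state (i + m.input)
      (Function.update T p m.copy.1) (p + m.copy.2) (if m.push then z + 1 else z)
      fun x => shiftTape (m.ops x) (V x) := by
  have ha : (scanMachine D e).action c =
      .act m.state (scanOps D e m fun j => c.tape j (c.head j)) := by
    have key : ∀ q r, scanMove D q (r .input) (r (.work (e.symm none)))
        (fun x => r (.work (e.symm (some x)))) = some m →
        scanStep D e q r = .act m.state (scanOps D e m r) := fun q r h => by
      unfold scanStep; rw [h]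
    exact key c.state (fun j => c.tape j (c.head j)) (h.move_eq.trans hm)
  unfold Machine.step
  rw [ha]
  constructor
  · rfl
  · change Function.update (c.tape .input) (c.head .input) (c.tape .input (c.head .input)) = _
    rw [Function.update_eq_self, h.input_tape]
  · change c.head .input + (m.input : ℤ) = _
    rw [h.input_head]
  · change Function.update (c.tape .numer) (c.head .numer)
      (if m.push then (some false, 1) else (c.tape .numer (c.head .numer), 0) :
        Option Bool × SignType).1 = _
    cases m.push
    · simp [h.numer_tape]
    · simp [h.numer_tape, h.numer_head, update_zeros]
  · change c.head .numer +
      (((if m.push then (some false, 1) else (c.tape .numer (c.head .numer), 0) :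
        Option Bool × SignType).2 : SignType) : ℤ) = _
    cases m.push <;> simp [h.numer_head]
  · change Function.update (c.tape .denom) (c.head .denom) (c.tape .denom (c.head .denom)) = _
    rw [Function.update_eq_self, h.denom_tape]
  · change c.head .denom + ((0 : SignType) : ℤ) = _
    simp [h.denom_head]
  · change Function.update (c.tape (.work (e.symm none))) (c.head (.work (e.symm none)))
      (scanOps D e m (fun j => c.tape j (c.head j)) (.work (e.symm none))).1 = _
    simp [scanOps, h.copy_tape, h.copy_head]
  · change c.head (.work (e.symm none)) +
      ((scanOps D e m (fun j => c.tape j (c.head j)) (.work (e.symm none))).2 : ℤ) = _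
    simp [scanOps, h.copy_head]
  · intro x
    refine (Machine.view_update (M := scanMachine D e) c m.state
      (scanOps D e m fun j => c.tape j (c.head j)) _).trans ?_
    rw [h.view]
    exact congrArg (fun o => shiftTape o (V x)) (scanOps_work_some D e m _ x)

/-- An operation that does not change the copy of the input. -/
theorem ScanAt.step_keep (h : ScanAt D e w c q i T p z V) {q' : ScanState D.Q} {a b : SignType}
    {push : Bool} {ov : ι → Option Bool × SignType} {i' p' : ℤ} {V' : ι → TapeContent}
    (hm : scanMove D q (tapeOf w i) (T p) (fun x => V x 0) = some ⟨q', a, (T p, b), push, ov⟩)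
    (hi : i + a = i') (hp : p + b = p') (hV : (fun x => shiftTape (ov x) (V x)) = V') :
    ScanAt D e w ((scanMachine D e).step Z c) q' i' T p' (if push then z + 1 else z) V' := by
  subst hi hp hV
  have := h.step (Z := Z) hm
  simpa using this

theorem tapeOf_natCast (w : List Bool) (n : ℕ) : tapeOf w n = w[n]? := by
  simp [tapeOf]

theorem tapeOf_of_neg (w : List Bool) {i : ℤ} (h : i < 0) : tapeOf w i = none := by
  rw [tapeOf, if_neg (by lia)]

theorem tapeOf_isSome (w : List Bool) {n : ℕ} (h : n < w.length) : (tapeOf w n).isSome = true := by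
  simp [tapeOf_natCast, h]

theorem tapeOf_length (w : List Bool) : tapeOf w w.length = none := by
  simp [tapeOf_natCast]

theorem tapeOf_nil : tapeOf [] = fun _ => none := by
  funext i; simp [tapeOf]

theorem update_tapeOf_take (w : List Bool) (p : ℕ) :
    Function.update (tapeOf (w.take p)) p (tapeOf w p) = tapeOf (w.take (p + 1)) := by
  funext i
  rw [Function.update_apply]
  split_ifs with h
  · subst h
    rw [tapeOf_natCast, tapeOf_natCast, List.getElem?_take_of_lt (Nat.lt_succ_self p)]
  · rcases lt_or_ge i 0 with hi | hi
    · rw [tapeOf_of_neg _ hi, tapeOf_of_neg _ hi]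
    · obtain ⟨n, rfl⟩ := Int.eq_ofNat_of_zero_le hi
      rw [tapeOf_natCast, tapeOf_natCast, List.getElem?_take, List.getElem?_take]
      split_ifs <;> first | rfl | lia

/-! ### Correctness and running time of the scanning machine -/

variable (D e w Z)

theorem scan_copying (p : ℕ) (hp : p ≤ w.length) :
    ScanAt D e w ((scanMachine D e).run Z w p) .copying p (tapeOf (w.take p)) p 0
      fun _ _ => none := by
  induction p with
  | zero =>
    constructor <;> try rfl
    · funext i
      change none = zeros 0 i
      rw [zeros, if_neg (by lia)]
    · change (fun _ => none) = tapeOf (w.take 0)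
      rw [List.take_zero, tapeOf_nil]
    · exact fun _ => rfl
  | succ p ih =>
    rw [Machine.run_succ]
    have := (ih (by lia)).step (Z := Z) (by rw [scanMove, if_pos (tapeOf_isSome w hp)])
    rw [update_tapeOf_take] at this
    have hv : (shiftTape (none, 0) fun _ => none) = fun _ => none := shiftTape_idle fun _ => none
    simpa [hv] using this

theorem scan_rewinding (r : ℕ) (hr : r ≤ w.length) :
    ScanAt D e w ((scanMachine D e).run Z w (w.length + 1 + r)) .rewinding (w.length - 1 - r)
      (tapeOf w) (w.length - 1 - r) 0 fun _ _ => none := by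
  induction r with
  | zero =>
    have h := scan_copying D e w Z w.length le_rfl
    rw [List.take_length] at h
    rw [add_zero, Machine.run_succ]
    refine h.step_keep (Z := Z) (push := false) (by rw [scanMove, tapeOf_length]; rfl)
      (by simp; lia) (by simp; lia) (funext fun x => shiftTape_idle _)
  | succ r ih =>
    rw [← add_assoc, Machine.run_succ]
    have h0 : (tapeOf w (w.length - 1 - r)).isSome = true := by
      have := tapeOf_isSome w (n := w.length - 1 - r) (by lia)
      rwa [show ((w.length - 1 - r : ℕ) : ℤ) = w.length - 1 - r by lia] at this
    exact (ih (by lia)).step_keep (Z := Z) (push := false) (by rw [scanMove, if_pos h0])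
      (by simp; lia) (by simp; lia) (funext fun x => shiftTape_idle _)

theorem scan_start :
    ScanAt D e w ((scanMachine D e).run Z w (2 * w.length + 2)) (.scan false true false D.start) 0
      (tapeOf w) 0 0 fun _ _ => none := by
  have h := scan_rewinding D e w Z w.length le_rfl
  rw [show 2 * w.length + 2 = w.length + 1 + w.length + 1 by ring, Machine.run_succ]
  exact h.step_keep (Z := Z) (push := false)
    (by rw [scanMove, tapeOf_of_neg w (by lia)]; rfl) (by simp) (by simp)
    (funext fun x => shiftTape_idle _)

/-- The invariant of the scan: `D` has made one step per complete pair, the head on the copy stands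
on the cell numbered by the ticks so far, and `alive` and `z` encode the capital. -/
theorem scan_main (m : ℕ) (hm : m ≤ w.length) : ∃ (alive : Bool) (z : ℕ),
    ScanAt D e w ((scanMachine D e).run Z w (2 * w.length + 2 + m))
      (.scan m.bodd alive (Nat.count D.Ticks (m / 2)).bodd (D.conf (m / 2)).1) m (tapeOf w)
      (Nat.count D.Ticks (m / 2)) z (D.conf (m / 2)).2 ∧
    betProduct (pairRatio D) (w.take m) = if alive then 2 ^ z else 0 := by
  induction m with
  | zero => exact ⟨true, 0, by simpa [Auto.conf] using scan_start D e w Z, by simp⟩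
  | succ m ih =>
    obtain ⟨alive, z, h, hd⟩ := ih (by lia)
    have hb := tapeOf_isSome w hm
    have hw : w[m]? = some (w.getD m false) := by
      rw [List.getD_eq_getElem?_getD, List.getElem?_eq_getElem hm]; rfl
    have htake : w.take (m + 1) = w.take m ++ [w.getD m false] := by
      rw [List.take_add_one, hw]; rfl
    have hlen : (w.take m).length = m := by simp; lia
    rw [← add_assoc, Machine.run_succ, htake, betProduct_append, hd]
    cases hodd : m.bodd
    · rw [hodd] at h
      have h2 : (m + 1) / 2 = m / 2 := by
        have := Nat.bodd_add_div2 m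
        rw [hodd, Nat.div2_val] at this
        simp at this
        lia
      refine ⟨alive, z, ?_, ?_⟩
      · rw [Nat.bodd_succ, hodd, h2]
        exact h.step_keep (Z := Z) (push := false) (b := 0) (a := 1)
          (by rw [scanMove, if_pos hb]; rfl) (by simp) (by simp)
          (funext fun x => shiftTape_idle _)
      · have hρ : ∀ a, pairRatio D (w.take m) a = 1 := fun a => by
          rw [pairRatio, hlen, if_neg (by simp [hodd])]
        rw [hρ, mul_one]
    · rw [hodd] at h
      have h2 : (m + 1) / 2 = m / 2 + 1 := by
        have := Nat.bodd_add_div2 m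
        rw [hodd, Nat.div2_val] at this
        simp at this
        lia
      -- The bit used for the comparison belongs to the prefix already read, so the bet is
      -- legitimate.
      have hcm : Nat.count D.Ticks (m / 2) < m := by
        have h3 := Nat.count_le (p := D.Ticks) (n := m / 2)
        have h4 : m ≠ 0 := by rintro rfl; simp at hodd
        lia
      have hnext : D.next (D.conf (m / 2)) = D.conf (m / 2 + 1) := (D.conf_succ _).symm
      rw [Nat.bodd_succ, hodd, h2, ← hnext, Nat.count_succ]
      by_cases ht : D.Ticks (m / 2)
      · have ht' : (D.tick (D.conf (m / 2)).1 fun x => (D.conf (m / 2)).2 x 0) = true := ht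
        have hstep := h.step_keep (Z := Z) (b := 1) (a := 1)
          (by rw [scanMove, if_pos hb, if_pos rfl, if_pos ht']) rfl rfl rfl
        rw [if_pos ht, Nat.bodd_succ]
        refine ⟨_, _, hstep, ?_⟩
        rw [tapeOf_natCast, tapeOf_natCast, hw]
        have hgetD : (w.take m).getD (Nat.count D.Ticks (m / 2)) false =
            w.getD (Nat.count D.Ticks (m / 2)) false := by
          rw [List.getD_eq_getElem?_getD, List.getD_eq_getElem?_getD,
            List.getElem?_take_of_lt hcm]
        have hgs : w[Nat.count D.Ticks (m / 2)]? =
            some (w.getD (Nat.count D.Ticks (m / 2)) false) := by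
          rw [List.getD_eq_getElem?_getD, List.getElem?_eq_getElem (by lia)]; rfl
        have hρ : pairRatio D (w.take m) (w.getD m false) =
            if (Nat.count D.Ticks (m / 2)).bodd = false then
              if w.getD m false = w.getD (Nat.count D.Ticks (m / 2)) false then 2 else 0
            else 1 := by
          simp only [pairRatio, hlen, hodd, ht, hgetD, true_and]
        rw [hρ, hgs]
        cases hpar : (Nat.count D.Ticks (m / 2)).bodd
        · by_cases hab : w.getD m false = w.getD (Nat.count D.Ticks (m / 2)) false
          · rw [hab]
            cases alive <;> simp [pow_succ]
          · have hab' : ((some (w.getD (Nat.count D.Ticks (m / 2)) false) : Option Bool) ==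
                some (w.getD m false)) = false := by
              simpa using fun h => hab h.symm
            rw [hab', if_pos rfl, if_neg hab]
            simp
        · simp
      · have ht' : ¬ (D.tick (D.conf (m / 2)).1 fun x => (D.conf (m / 2)).2 x 0) = true := ht
        have hstep := h.step_keep (Z := Z) (b := 0) (a := 1)
          (by rw [scanMove, if_pos hb, if_pos rfl, if_neg ht']) rfl rfl rfl
        refine ⟨alive, z, ?_, ?_⟩
        · rw [if_neg ht]
          simpa [Auto.next] using hstep
        · have hρ : ∀ a, pairRatio D (w.take m) a = 1 := fun a => by
            rw [pairRatio, hlen, if_neg (by simp [ht])]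
          rw [hρ, mul_one]

variable {D e w Z}

theorem blockLength_eq {T : TapeContent} {n : ℕ} (h : T n = none)
    (h' : ∀ i < n, T (i : ℤ) ≠ none) : blockLength T = n := by
  refine le_antisymm (Nat.sInf_le h) (le_csInf ⟨n, h⟩ fun i hi => ?_)
  by_contra! hlt
  exact h' i hlt hi

theorem binaryValue_zeros (z : ℕ) : binaryValue (zeros z) = 0 := by
  unfold binaryValue
  refine Finset.sum_eq_zero fun i _ => ?_
  simp only [zeros]
  split_ifs <;> simp_all

theorem binaryValue_update_zeros (z : ℕ) :
    binaryValue (Function.update (zeros z) z (some true)) = 2 ^ z := by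
  have hl : blockLength (Function.update (zeros z) z (some true)) = z + 1 := by
    refine blockLength_eq ?_ fun i hi => ?_
    · rw [Function.update_of_ne (by push_cast; lia), zeros, if_neg (by push_cast; lia)]
    · rw [Function.update_apply]
      split_ifs
      · simp
      · rw [zeros, if_pos (by lia)]; simp
  rw [binaryValue, hl, Finset.sum_range_succ, Finset.sum_eq_zero fun i hi => ?_]
  · simp
  · rw [Finset.mem_range] at hi
    rw [Function.update_of_ne (by lia), if_neg]
    simp only [zeros]
    split_ifs <;> simp

variable (D e w Z)

/-- Copying and rewinding take `2|w| + 2` steps, the scan takes `|w|`, and writing the last digits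
takes one. -/
theorem scanMachine_outputs :
    (scanMachine D e).OutputsWithin Z w (3 * w.length + 3) (betProduct (pairRatio D) w) := by
  obtain ⟨alive, z, h, hd⟩ := scan_main D e w Z w.length le_rfl
  rw [List.take_length] at hd
  have hrun : (scanMachine D e).run Z w (3 * w.length + 3) = (scanMachine D e).step Z
      ((scanMachine D e).run Z w (2 * w.length + 2 + w.length)) := by
    rw [← Machine.run_succ]; congr 1; ring
  generalize (scanMachine D e).run Z w (2 * w.length + 2 + w.length) = c at h hrun
  have ha : (scanMachine D e).action c =
      .act .done (finishOps alive fun j => c.tape j (c.head j)) := by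
    have key : ∀ a b d q' r, scanMove D q' (r .input) (r (.work (e.symm none)))
        (fun x => r (.work (e.symm (some x)))) = none → q' = .scan a alive b d →
        scanStep D e q' r = .act .done (finishOps alive r) := fun a b d q' r h hq => by
      unfold scanStep
      rw [h, hq]
    refine key _ _ _ c.state (fun j => c.tape j (c.head j)) (h.move_eq.trans ?_) h.state
    rw [scanMove, tapeOf_length]
    rfl
  have hhalt : (scanMachine D e).Halted ((scanMachine D e).step Z c) := by
    have hs := (Machine.step_of_act (Z := Z) ha).1
    unfold Machine.Halted Machine.action
    rw [hs]
    rfl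
  have hdenom : ((scanMachine D e).step Z c).tape .denom =
      Function.update (zeros 0) (0 : ℕ) (some true) := by
    unfold Machine.step
    rw [ha]
    change Function.update (c.tape .denom) (c.head .denom) (some true) = _
    rw [h.denom_tape, h.denom_head]
    congr 1
    funext i
    rw [zeros, if_neg (by lia)]
  have hnumer : ((scanMachine D e).step Z c).tape .numer =
      if alive then Function.update (zeros z) z (some true) else zeros z := by
    unfold Machine.step
    rw [ha]
    change Function.update (c.tape .numer) (c.head .numer)
      (if alive then some true else c.tape .numer (c.head .numer)) = _
    cases alive
    · simp [h.numer_tape]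
    · simp [h.numer_tape, h.numer_head]
  unfold Machine.OutputsWithin
  rw [hrun, hdenom, hnumer, binaryValue_update_zeros]
  refine ⟨hhalt, by simp, ?_⟩
  rw [hd]
  cases alive
  · simp [binaryValue_zeros]
  · simp [binaryValue_update_zeros]

end Scan

theorem isBoundedMartingale_pairRatio {ι : Type} [Finite ι] (D : Auto ι) {t : ℕ → ℕ}
    (ht : Superlinear t) : IsBoundedMartingale t (betProduct (pairRatio D)) := by
  obtain ⟨k, ⟨e⟩⟩ := Finite.exists_equiv_fin (Option ι)
  have hev := ht.bound (c := 1) one_pos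
  rw [eventually_atTop] at hev
  obtain ⟨N, hN⟩ := hev
  refine ⟨isMartingale_betProduct (pairRatio_add D), scanMachine D e.symm,
    scanMachine_oracleFree D e.symm, 3 * N + 3, fun w Z => ?_⟩
  -- For `N ≤ |w|` superlinearity gives `|w| ≤ t |w|`; shorter words are covered by the additive
  -- constant.
  have hle : 3 * w.length + 3 ≤ (3 * N + 3) * t w.length + (3 * N + 3) := by
    rcases le_total N w.length with h | h
    · have h1 := hN _ h
      have h2 : w.length ≤ t w.length := by
        simp at h1
        exact_mod_cast h1
      nlinarith
    · nlinarith
  have h := scanMachine_outputs D e.symm w Z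
  unfold Machine.OutputsWithin
  rw [Machine.run_of_halted h.1 hle]
  exact h

/-- On this sequence every bet is won, so the capital doubles at each even-numbered tick and never
drops. -/
theorem succeeds_pairRatio {ι : Type} (D : Auto ι) (hD : {s | D.Ticks s}.Infinite) (Y : BinSeq) :
    Succeeds (betProduct (pairRatio D))
      (interleave (Y ∘ fun i => Nat.nth D.Ticks (2 * i)) Y) := by
  set b : ℕ → ℕ := fun i => Nat.nth D.Ticks (2 * i) with hb
  set X := interleave (Y ∘ b) Y with hX
  -- With ticks numbered from `0`, the exponent counts the even numbers among those of the ticks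
  -- before time `n`.
  have hval : ∀ n, betProduct (pairRatio D) (pre X (2 * n)) =
      2 ^ ((Nat.count D.Ticks n + 1) / 2) := fun n => by
    induction n with
    | zero => simp [pre]
    | succ n ih =>
      rw [show 2 * (n + 1) = 2 * n + 1 + 1 by ring, pre_succ, pre_succ, betProduct_append,
        betProduct_append, ih, ← pre_succ, pairRatio, if_neg (by simp), mul_one, pairRatio]
      have h2 : (2 * n + 1) / 2 = n := by lia
      simp only [length_pre, h2, Nat.count_succ]
      by_cases ht : D.Ticks n
      · cases hpar : (Nat.count D.Ticks n).bodd
        · rw [if_pos ⟨by simp, ht, rfl⟩]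
          have hmod := Nat.bodd_add_div2 (Nat.count D.Ticks n)
          rw [hpar, Nat.div2_val] at hmod
          simp at hmod
          have hle := Nat.count_le (p := D.Ticks) (n := n)
          -- The number of this tick is some `2i`, so the bit is `A i = Y (b i)`, and `b i = n`
          -- because the tick numbered `2i` occurs at time `n`.
          have hXc : X (Nat.count D.Ticks n) = Y n := by
            rw [hX, interleave, if_pos (by lia), Function.comp, hb]
            simp only
            rw [hmod, Nat.nth_count ht]
          have hXn : X (2 * n + 1) = Y n := by
            rw [hX, interleave, if_neg (by lia), h2]
          rw [pre_getD X (by lia), hXc, hXn, if_pos rfl, if_pos ht, ← pow_succ]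
          congr 1
          lia
        · rw [if_neg (by simp), if_pos ht, mul_one]
          have hmod := Nat.bodd_add_div2 (Nat.count D.Ticks n)
          rw [hpar, Nat.div2_val] at hmod
          simp at hmod
          congr 1
          lia
      · rw [if_neg (by simp [ht]), if_neg ht, mul_one, add_zero]
  refine succeeds_of_unbounded fun K n₀ => ?_
  -- The summand `n₀` takes the position beyond `n₀`, and `2K` ticks provide at least `K` doublings.
  refine ⟨2 * Nat.nth D.Ticks (2 * K + n₀), ?_, ?_⟩
  · have := (Nat.nth_strictMono hD).le_apply (x := 2 * K + n₀)
    lia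
  · rw [hval, Nat.count_nth_of_infinite hD]
    have h1 : K ≤ 2 ^ ((2 * K + n₀ + 1) / 2) :=
      Nat.lt_two_pow_self.le.trans (Nat.pow_le_pow_right (by norm_num) (by lia))
    exact_mod_cast h1

end TimeBounded

end

/-! ### The main theorem -/

theorem mainTheorem1 (t : ℕ → ℕ) (ht : TimeBounded.Superlinear t)
    (hc : TimeBounded.TimeConstructible t) :
    ∃ A B : TimeBounded.BinSeq,
      TimeBounded.IsRandom t B ∧
      TimeBounded.IsRandomRel t B A ∧
      ¬ TimeBounded.IsRandom t (TimeBounded.interleave A B) := by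
  obtain ⟨ι, hι, E, hinf, hE⟩ := hc.exists_auto
  have hinf' := TimeBounded.Auto.slow_infinite hinf
  have hb : StrictMono fun i => Nat.nth E.slow.Ticks (2 * i) :=
    (Nat.nth_strictMono hinf').comp fun i j h => by lia
  obtain ⟨Y, hY, hA⟩ := TimeBounded.exists_random_comp t _ hb fun C => by
    -- The threshold makes `e ≥ 2i ≥ 4C + 20`, so that `C * e + C + 2 ≤ e * e ≤ 2 ^ e`.
    refine ⟨2 * C + 10, fun i hi n hn => ?_⟩
    obtain ⟨e, he, hcount, hpow⟩ :=
      TimeBounded.Auto.slow_ticks (Nat.nth_mem_of_infinite hinf' (2 * i))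
    rw [Nat.count_nth_of_infinite hinf'] at hcount
    have hnth : Nat.nth E.Ticks (2 * i) = e := by rw [← hcount, Nat.nth_count he]
    -- No monotonicity of `t` is needed: `t n` is at most the time of tick `n` of `E`, and `n ≤ i +
    -- 1 ≤ 2i`.
    have htn : t n ≤ e := by
      have h1 := hE _ (Nat.nth_mem_of_infinite hinf n)
      rw [Nat.count_nth_of_infinite hinf] at h1
      rw [← hnth]
      exact h1.trans ((Nat.nth_strictMono hinf).monotone (by lia))
    have hie : 2 * i ≤ e := by
      rw [← hnth]; exact (Nat.nth_strictMono hinf).le_apply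
    -- The additional `1` in the exponent compensates for the `+ 1` in the bound of `slow_ticks`.
    have hexp : C * t n + C + 1 ≤ 2 ^ e - 1 := by
      have hsq : ∀ m : ℕ, 10 ≤ m → m * m ≤ 2 ^ m := fun m hm => by
        induction m, hm using Nat.le_induction with
        | base => norm_num
        | succ m hm ih => rw [pow_succ]; nlinarith
      have h1 := hsq e (by lia)
      have h2 : C * t n + C + 2 ≤ e * e := by
        have : C * t n ≤ C * e := Nat.mul_le_mul_left _ htn
        nlinarith
      lia
    have h3 := (Nat.pow_le_pow_right (n := 2) (by norm_num) hexp).trans hpow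
    rw [pow_succ] at h3
    have h4 : 0 < 2 ^ (C * t n + C) := by positivity
    lia
  exact ⟨_, Y, hY, hA, fun h => h ⟨_, TimeBounded.isBoundedMartingale_pairRatio E.slow ht,
    TimeBounded.succeeds_pairRatio E.slow hinf' Y⟩⟩
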